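/- **Setting.** Let $\mathscr C$ be a variety of finitary algebras and $\mathscr D$ a variety of finitary algebras or of ordered algebras (posets with monotone operations, axiomatised by inequalities between terms). Assume: $\mathscr C$ and $\mathscr D$ are locally finite (free algebras on finite sets are finite); epimorphisms in $\mathscr D$ are surjective; $\mathscr D$ is entropic (any two operations commute with each other); and $\mathscr C$, $\mathscr D$ are predual, i.e. a dual equivalence $S\colon \mathscr C_f \simeq \mathscr D_f^{\mathrm{op}} : P$ between the categories of finite algebras is given. Write $\Psi X$ for the free $\mathscr D$-algebra on a set $X$, and $\mathbf 1_{\mathscr C},\mathbf 1_{\mathscr D}$ for the free algebras on one generator. Put $O_{\mathscr C}=P\mathbf 1_{\mathscr D}$ and $O_{\mathscr D}=S\mathbf 1_{\mathscr C}$, whose underlying sets are identified through the canonical bijections $|O_{\mathscr C}|\cong\mathscr C(\mathbf 1_{\mathscr C},P\mathbf 1_{\mathscr D})\cong\mathscr D(\mathbf 1_{\mathscr D},S\mathbf 1_{\mathscr C})\cong|O_{\mathscr D}|$; assume that $|O_{\mathscr C}|$ is identified with the two-element set $\{\mathtt{yes},\mathtt{no}\}$. A *$\mathscr D$-monoid*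 is a $\mathscr D$-algebra with a monoid structure whose multiplication is a $\mathscr D$-homomorphism in each variable. The free $\mathscr D$-monoid on $\Sigma$ is $\Psi\Sigma^*$, with multiplication extending concatenation of words. The category $\mathbf{Free}(\mathbf{Mon}\,\mathscr D)$ has finite sets $\Sigma$ as objects and $\mathscr D$-monoid morphisms $\Psi\Sigma^*\to\Psi\Delta^*$ as morphisms $\Sigma\to\Delta$. *Languages.* For finite $\Sigma$, the set $\mathrm{Reg}(\Sigma)$ of regular languages over $\Sigma$ carries the structure of the rational fixpoint of the functor $O_{\mathscr C}\times(-)^\Sigma$ on $\mathscr C$ (the colimit of all its finite coalgebras): the $\mathscr C$-operations act wordwise on membership, the output says whether $\varepsilon\in L$, and the transitions are the left derivatives. A *local variety of languages over $\Sigma$ in $\mathscr C$* is a subcoalgebra of $\mathrm{Reg}(\Sigma)$ closed under right derivatives $La^{-1}=\{w : wa\in L\}$, $a\in\Sigma$. Identify a language $L\subseteq\Delta^*$ with the $\mathscr D$-morphism $L\colon\Psi\Delta^*\to O_{\mathscr D}$ extending its characteristic function; its preimage under $f\colon\Psi\Sigma^*\to\Psi\Delta^*$ is the language over $\Sigma$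 given by $L\circ f$. The category $\mathbf{FLang}$ has as objects the pairs $(\Sigma,V)$ of a finite set $\Sigma$ and a local variety $V$ over $\Sigma$; morphisms $(\Sigma,V)\to(\Delta,W)$ are the $\mathscr D$-monoid morphisms $f\colon\Psi\Sigma^*\to\Psi\Delta^*$ such that taking preimages under $f$ restricts to a $\mathscr C$-morphism $W\to V$. *Monoids.* A finite $\Sigma$-generated $\mathscr D$-monoid is a surjective $\mathscr D$-monoid morphism $e_M\colon\Psi\Sigma^*\twoheadrightarrow M$ with $M$ finite; their isomorphism classes form a poset, where $M\le N$ iff $e_M=h\,e_N$ for some $\mathscr D$-monoid morphism $h\colon N\to M$. A *local pseudovariety of $\mathscr D$-monoids over $\Sigma$* is an ideal of this poset (a nonempty, directed, downward closed subset). The category $\mathbf{FVar}$ has as objects the pairs $(\Sigma,P)$ of a finite set $\Sigma$ and a local pseudovariety $P$ over $\Sigma$; morphisms $(\Sigma,P)\to(\Delta,Q)$ are the $\mathscr D$-monoid morphisms $f\colon\Psi\Sigma^*\to\Psi\Delta^*$ such that for every $N\in Q$ there are $M\in P$ and a $\mathscr D$-monoid morphism $g\colon M\to N$ with $e_N f=g\,e_M$.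 **Theorem.** The projections $p\colon\mathbf{FLang}\to\mathbf{Free}(\mathbf{Mon}\,\mathscr D)$ and $q\colon\mathbf{FVar}\to\mathbf{Free}(\mathbf{Mon}\,\mathscr D)$, sending $(\Sigma,V)$ and $(\Sigma,P)$ to $\Sigma$ and a morphism $f$ to $f$, are opfibrations, and they are isomorphic: there is an isomorphism of categories $I\colon\mathbf{FLang}\cong\mathbf{FVar}$ with $q\circ I=p$. -/

import Mathlib

open CategoryTheory

universe u v

noncomputable section

namespace EilenbergFib

/-! ### Varieties of (possibly ordered) algebras -/

/-- A finitary (single-sorted) signature. -/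
structure Signature : Type (u + 1) where
  /-- the operation symbols -/
  ops : Type u
  /-- the arity of an operation symbol -/
  arity : ops → ℕ

/-- Terms over a signature `Γ` with variables in `X`. -/
inductive Term (Γ : Signature.{u}) (X : Type v) : Type (max u v)
  | var (x : X) : Term Γ X
  | app (σ : Γ.ops) (t : Fin (Γ.arity σ) → Term Γ X) : Term Γ X

/-- Evaluation of a term under an interpretation of the operation symbols and a valuation. -/
def Term.eval {Γ : Signature.{u}} {X : Type v} {A : Type*}
    (op : ∀ σ : Γ.ops, (Fin (Γ.arity σ) → A) → A) (ρ : X → A) : Term Γ X → A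
  | .var x => ρ x
  | .app σ t => op σ fun i => (t i).eval op ρ

/-- Substitution of terms for variables. -/
def Term.subst {Γ : Signature.{u}} {X Y : Type*} (s : X → Term Γ Y) : Term Γ X → Term Γ Y :=
  Term.eval Term.app s

/-- A variety, given by a signature and a set of axioms `t₁ ≤ t₂`. If `ordered` holds, it is a
variety of ordered algebras. Otherwise it is a variety of ordinary algebras; those are handled as
discretely ordered algebras, so that an axiom `t₁ ≤ t₂` is the equation `t₁ = t₂`, and
monotonicity of operations and homomorphisms is automatic. -/
structure Variety : Type (u + 1) where
  /-- the signature -/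
  sig : Signature.{u}
  /-- whether the algebras are ordered -/
  ordered : Prop
  /-- the axioms: a pair `(t₁, t₂)` stands for `t₁ ≤ t₂` -/
  ax : Set (Term sig ℕ × Term sig ℕ)

/-- The algebras of a variety: posets with monotone operations that satisfy the axioms. The
carrier may be empty. In a variety of ordinary algebras the order is equality. -/
structure Alg (𝒱 : Variety.{u}) : Type (u + 1) where
  /-- the underlying set -/
  carrier : Type u
  /-- the order -/
  po : PartialOrder carrier
  /-- the operations -/
  op : ∀ σ : 𝒱.sig.ops, (Fin (𝒱.sig.arity σ) → carrier) → carrier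
  op_mono : ∀ σ, Monotone (op σ)
  discrete : ¬ 𝒱.ordered → ∀ x y : carrier, x ≤ y → x = y
  sat : ∀ p ∈ 𝒱.ax, ∀ ρ : ℕ → carrier, p.1.eval op ρ ≤ p.2.eval op ρ

instance (𝒱 : Variety.{u}) : CoeSort (Alg 𝒱) (Type u) := ⟨Alg.carrier⟩

instance {𝒱 : Variety.{u}} (A : Alg 𝒱) : PartialOrder A := A.po

/-- A map between algebras is a homomorphism if it is monotone and preserves all operations. -/
structure IsHom {𝒱 : Variety.{u}} {A B : Alg 𝒱} (f : A → B) : Prop where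
  mono : Monotone f
  map_op : ∀ σ x, f (A.op σ x) = B.op σ fun i => f (x i)

/-- Homomorphisms of algebras. -/
@[ext]
structure Alg.Hom {𝒱 : Variety.{u}} (A B : Alg 𝒱) : Type u where
  /-- the underlying map -/
  toFun : A → B
  isHom : IsHom toFun

instance (𝒱 : Variety.{u}) : Category.{u} (Alg 𝒱) where
  Hom := Alg.Hom
  id _ := ⟨id, monotone_id, fun _ _ => rfl⟩
  comp f g := ⟨g.toFun ∘ f.toFun, g.isHom.mono.comp f.isHom.mono, fun σ x => by
    simp [f.isHom.map_op, g.isHom.map_op]⟩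

instance {𝒱 : Variety.{u}} (A B : Alg 𝒱) : CoeFun (A ⟶ B) fun _ => A → B := ⟨Alg.Hom.toFun⟩

/-- The full subcategory of finite algebras. -/
abbrev FinAlg (𝒱 : Variety.{u}) : Type (u + 1) :=
  ObjectProperty.FullSubcategory fun A : Alg 𝒱 => Finite A

section Basics

variable {𝒱 : Variety.{u}}

@[simp] theorem id_apply {A : Alg 𝒱} (x : A) : (𝟙 A : A ⟶ A) x = x := rfl

@[simp] theorem comp_apply {A B E : Alg 𝒱} (f : A ⟶ B) (g : B ⟶ E) (x : A) :
    (f ≫ g) x = g (f x) := rfl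

theorem hom_ext {A B : Alg 𝒱} {f g : A ⟶ B} (h : ∀ x, f x = g x) : f = g :=
  Alg.Hom.ext (funext h)

theorem IsHom.map_eval {A B : Alg 𝒱} {f : A → B} (hf : IsHom f) {X : Type*} (ρ : X → A)
    (t : Term 𝒱.sig X) : f (t.eval A.op ρ) = t.eval B.op (f ∘ ρ) := by
  induction t with
  | var x => rfl
  | app σ t ih => simp only [Term.eval, hf.map_op, ih]

theorem eval_mono (A : Alg 𝒱) {X : Type*} {ρ ρ' : X → A} (h : ∀ x, ρ x ≤ ρ' x)
    (t : Term 𝒱.sig X) : t.eval A.op ρ ≤ t.eval A.op ρ' := by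
  induction t with
  | var x => exact h x
  | app σ t ih => exact A.op_mono σ ih

theorem eval_subst {Γ : Signature.{u}} {A X Y : Type*}
    (op : ∀ σ : Γ.ops, (Fin (Γ.arity σ) → A) → A) (ρ : Y → A) (s : X → Term Γ Y) (t : Term Γ X) :
    (t.subst s).eval op ρ = t.eval op fun x => (s x).eval op ρ := by
  induction t with
  | var x => rfl
  | app σ t ih =>
    change op σ (fun i => ((t i).subst s).eval op ρ) = _
    simp only [ih]; rfl

end Basics

/-! ### Free algebras -/

/-- Terms, to be preordered by the inequalities that hold in the variety. -/
def PreFree (𝒱 : Variety.{u}) (X : Type u) : Type u := Term 𝒱.sig X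

instance (𝒱 : Variety.{u}) (X : Type u) : Preorder (PreFree 𝒱 X) where
  le t s := ∀ (A : Alg 𝒱) (ρ : X → A), Term.eval A.op ρ t ≤ Term.eval A.op ρ s
  le_refl _ _ _ := le_rfl
  le_trans _ _ _ h h' A ρ := (h A ρ).trans (h' A ρ)

section Free

variable {𝒱 : Variety.{u}} {X : Type u}

/-- The carrier of the free algebra: terms modulo the equations that hold in the variety. -/
abbrev FreeCarrier (𝒱 : Variety.{u}) (X : Type u) : Type u :=
  Antisymmetrization (PreFree 𝒱 X) (· ≤ ·)

/-- The class of a term. -/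
def FreeCarrier.mk (t : Term 𝒱.sig X) : FreeCarrier 𝒱 X :=
  toAntisymmetrization (α := PreFree 𝒱 X) (· ≤ ·) t

theorem FreeCarrier.mk_le {t s : Term 𝒱.sig X} :
    FreeCarrier.mk (𝒱 := 𝒱) t ≤ FreeCarrier.mk s ↔
      ∀ (A : Alg 𝒱) (ρ : X → A), t.eval A.op ρ ≤ s.eval A.op ρ := Iff.rfl

/-- A representing term. -/
def FreeCarrier.rep (x : FreeCarrier 𝒱 X) : Term 𝒱.sig X :=
  ofAntisymmetrization (α := PreFree 𝒱 X) (· ≤ ·) x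

@[simp] theorem FreeCarrier.mk_rep (x : FreeCarrier 𝒱 X) : FreeCarrier.mk x.rep = x :=
  toAntisymmetrization_ofAntisymmetrization (α := PreFree 𝒱 X) (· ≤ ·) x

theorem FreeCarrier.rep_eval (A : Alg 𝒱) (ρ : X → A) (t : Term 𝒱.sig X) :
    (FreeCarrier.mk (𝒱 := 𝒱) t).rep.eval A.op ρ = t.eval A.op ρ := by
  have h := FreeCarrier.mk_rep (FreeCarrier.mk (𝒱 := 𝒱) t)
  exact le_antisymm (FreeCarrier.mk_le.1 h.le A ρ) (FreeCarrier.mk_le.1 h.ge A ρ)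

theorem FreeCarrier.mk_eq {t s : Term 𝒱.sig X}
    (h : ∀ (A : Alg 𝒱) (ρ : X → A), t.eval A.op ρ = s.eval A.op ρ) :
    FreeCarrier.mk (𝒱 := 𝒱) t = FreeCarrier.mk s :=
  le_antisymm (FreeCarrier.mk_le.2 fun A ρ => (h A ρ).le)
    (FreeCarrier.mk_le.2 fun A ρ => (h A ρ).ge)

/-- The operations on the free algebra, induced by term formation. -/
def FreeCarrier.op (σ : 𝒱.sig.ops) (x : Fin (𝒱.sig.arity σ) → FreeCarrier 𝒱 X) :
    FreeCarrier 𝒱 X := FreeCarrier.mk (Term.app σ fun i => (x i).rep)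

theorem FreeCarrier.eval_op {Y : Type*} (ρ : Y → FreeCarrier 𝒱 X) (t : Term 𝒱.sig Y) :
    t.eval FreeCarrier.op ρ = FreeCarrier.mk (t.subst fun y => (ρ y).rep) := by
  induction t with
  | var y => exact (FreeCarrier.mk_rep _).symm
  | app σ t ih =>
    refine FreeCarrier.mk_eq fun A ρ' => ?_
    change A.op σ _ = A.op σ _
    congr 1; funext i
    change ((t i).eval FreeCarrier.op ρ).rep.eval A.op ρ' = _
    rw [ih, FreeCarrier.rep_eval]
    rfl

/-- The free algebra of the variety `𝒱` on the set `X`. -/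
def Free (𝒱 : Variety.{u}) (X : Type u) : Alg 𝒱 where
  carrier := FreeCarrier 𝒱 X
  po := inferInstance
  op := FreeCarrier.op
  op_mono σ x y h := FreeCarrier.mk_le.2 fun A ρ => A.op_mono σ fun i => by
    have := h i
    rw [← FreeCarrier.mk_rep (x i), ← FreeCarrier.mk_rep (y i)] at this
    exact FreeCarrier.mk_le.1 this A ρ
  discrete hd x y h := by
    rw [← FreeCarrier.mk_rep x, ← FreeCarrier.mk_rep y] at h ⊢
    exact FreeCarrier.mk_eq fun A ρ => A.discrete hd _ _ (FreeCarrier.mk_le.1 h A ρ)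
  sat p hp ρ := by
    rw [FreeCarrier.eval_op, FreeCarrier.eval_op]
    refine FreeCarrier.mk_le.2 fun A ρ' => ?_
    rw [eval_subst, eval_subst]
    exact A.sat p hp _

/-- The insertion of generators. -/
def Free.of (x : X) : Free 𝒱 X := FreeCarrier.mk (.var x)

/-- The unique homomorphic extension of a map defined on the generators. -/
def Free.lift {A : Alg 𝒱} (ρ : X → A) : Free 𝒱 X ⟶ A where
  toFun x := (FreeCarrier.rep x).eval A.op ρ
  isHom :=
    { mono := fun x y h => by
        rw [← FreeCarrier.mk_rep x, ← FreeCarrier.mk_rep y] at h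
        exact FreeCarrier.mk_le.1 h A ρ
      map_op := fun σ x => FreeCarrier.rep_eval A ρ _ }

@[simp] theorem Free.lift_of {A : Alg 𝒱} (ρ : X → A) (x : X) :
    (Free.lift ρ : Free 𝒱 X ⟶ A) (Free.of x) = ρ x := FreeCarrier.rep_eval A ρ _

theorem Free.eq_eval (x : Free 𝒱 X) : x = (FreeCarrier.rep x).eval (Free 𝒱 X).op Free.of := by
  have h := FreeCarrier.eval_op (𝒱 := 𝒱) (X := X) Free.of (FreeCarrier.rep x)
  refine Eq.trans ?_ h.symm
  conv_lhs => rw [← FreeCarrier.mk_rep x]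
  refine FreeCarrier.mk_eq fun A ρ => ?_
  rw [eval_subst]
  congr 1; funext y
  exact (FreeCarrier.rep_eval A ρ (.var y)).symm

theorem Free.isHom_ext {A : Alg 𝒱} {f g : Free 𝒱 X → A} (hf : IsHom f) (hg : IsHom g)
    (h : ∀ x, f (Free.of x) = g (Free.of x)) (x : Free 𝒱 X) : f x = g x := by
  rw [Free.eq_eval x, hf.map_eval, hg.map_eval]
  congr 1; funext y; exact h y

theorem Free.hom_ext {A : Alg 𝒱} {f g : Free 𝒱 X ⟶ A}
    (h : ∀ x, f (Free.of x) = g (Free.of x)) : f = g :=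
  EilenbergFib.hom_ext (Free.isHom_ext f.isHom g.isHom h)

/-- The universal property of the free algebra. -/
def Free.homEquiv (X : Type u) (A : Alg 𝒱) : (Free 𝒱 X ⟶ A) ≃ (X → A) where
  toFun f x := f (Free.of x)
  invFun := Free.lift
  left_inv _ := Free.hom_ext fun _ => Free.lift_of _ _
  right_inv _ := funext fun _ => Free.lift_of _ _

end Free

/-- A variety is locally finite if free algebras on finite sets are finite. -/
def Variety.LocallyFinite (𝒱 : Variety.{u}) : Prop :=
  ∀ X : Type u, Finite X → Finite (Free 𝒱 X)

/-- Any two operations commute with each other. -/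
def Variety.Entropic (𝒱 : Variety.{u}) : Prop :=
  ∀ (A : Alg 𝒱) (σ τ : 𝒱.sig.ops) (x : Fin (𝒱.sig.arity σ) → Fin (𝒱.sig.arity τ) → A),
    A.op σ (fun i => A.op τ fun j => x i j) = A.op τ fun j => A.op σ fun i => x i j

/-! ### Monoids in an entropic variety -/

/-- A `𝒱`-monoid: an algebra with a monoid structure whose multiplication is a bimorphism. -/
structure VMon (𝒱 : Variety.{u}) : Type (u + 1) where
  /-- the underlying algebra -/
  alg : Alg 𝒱
  /-- the monoid structure -/
  mon : Monoid alg
  isHom_mul_left : ∀ a : alg, IsHom fun b : alg => a * b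
  isHom_mul_right : ∀ b : alg, IsHom fun a : alg => a * b

instance {𝒱 : Variety.{u}} (M : VMon 𝒱) : Monoid M.alg := M.mon

/-- Morphisms of `𝒱`-monoids. -/
@[ext]
structure VMon.Hom {𝒱 : Variety.{u}} (M N : VMon 𝒱) : Type u where
  /-- the underlying homomorphism of algebras -/
  hom : M.alg ⟶ N.alg
  map_one : hom 1 = 1
  map_mul : ∀ a b, hom (a * b) = hom a * hom b

instance (𝒱 : Variety.{u}) : Category.{u} (VMon 𝒱) where
  Hom := VMon.Hom
  id _ := ⟨𝟙 _, rfl, fun _ _ => rfl⟩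
  comp f g := ⟨f.hom ≫ g.hom, by simp [f.map_one, g.map_one], fun a b => by
    simp [f.map_mul, g.map_mul]⟩

section FreeMonoid

variable {𝒱 : Variety.{u}}

/-- In an entropic variety, terms preserve homomorphisms. -/
theorem isHom_eval (h𝒱 : 𝒱.Entropic) {A B : Alg 𝒱} {X : Type*} (g : X → A → B)
    (hg : ∀ x, IsHom (g x)) (t : Term 𝒱.sig X) : IsHom fun a => t.eval B.op fun x => g x a := by
  induction t with
  | var x => exact hg x
  | app σ t ih =>
    refine ⟨fun a b h => B.op_mono σ fun i => (ih i).mono h, fun τ a => ?_⟩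
    change B.op σ (fun i => (fun a => (t i).eval B.op fun x => g x a) (A.op τ a)) = _
    simp only [(ih _).map_op]
    exact h𝒱 B σ τ _

/-- The multiplication of the free `𝒱`-monoid, extending concatenation of words. -/
def freeMul {Θ : Type u} (x y : Free 𝒱 (List Θ)) : Free 𝒱 (List Θ) :=
  (Free.lift fun w : List Θ => (Free.lift fun w' : List Θ => Free.of (𝒱 := 𝒱) (w ++ w')) y) x

theorem freeMul_of_of {Θ : Type u} (w w' : List Θ) :
    freeMul (𝒱 := 𝒱) (Free.of w) (Free.of w') = Free.of (w ++ w') := by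
  simp [freeMul]

theorem isHom_freeMul_right {Θ : Type u} (y : Free 𝒱 (List Θ)) : IsHom fun x => freeMul x y :=
  (Free.lift _).isHom

theorem isHom_freeMul_left (h𝒱 : 𝒱.Entropic) {Θ : Type u} (x : Free 𝒱 (List Θ)) :
    IsHom fun y => freeMul x y :=
  isHom_eval h𝒱 _ (fun _ => (Free.lift _).isHom) _

theorem IsHom.comp {A B E : Alg 𝒱} {g : B → E} {f : A → B} (hg : IsHom g) (hf : IsHom f) :
    IsHom fun x => g (f x) :=
  ⟨hg.mono.comp hf.mono, fun σ x => by simp only [hf.map_op, hg.map_op]⟩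

theorem freeMul_assoc (h𝒱 : 𝒱.Entropic) {Θ : Type u} (x y z : Free 𝒱 (List Θ)) :
    freeMul (freeMul x y) z = freeMul x (freeMul y z) := by
  refine Free.isHom_ext ((isHom_freeMul_right z).comp (isHom_freeMul_right y))
    (isHom_freeMul_right _) (fun a => ?_) x
  refine Free.isHom_ext ((isHom_freeMul_right z).comp (isHom_freeMul_left h𝒱 _))
    ((isHom_freeMul_left h𝒱 _).comp (isHom_freeMul_right z)) (fun b => ?_) y
  refine Free.isHom_ext (isHom_freeMul_left h𝒱 _)
    ((isHom_freeMul_left h𝒱 _).comp (isHom_freeMul_left h𝒱 _)) (fun c => ?_) z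
  simp [freeMul_of_of]

theorem isHom_id (A : Alg 𝒱) : IsHom fun x : A => x := ⟨monotone_id, fun _ _ => rfl⟩

/-- The free `𝒱`-monoid on the set `Θ`, carried by the free algebra on the set of words. -/
def freeVMon (h𝒱 : 𝒱.Entropic) (Θ : Type u) : VMon 𝒱 where
  alg := Free 𝒱 (List Θ)
  mon :=
    { mul := freeMul
      one := Free.of []
      mul_assoc := freeMul_assoc h𝒱
      one_mul := fun x => Free.isHom_ext (f := fun x => freeMul (Free.of []) x)
        (isHom_freeMul_left h𝒱 _) (isHom_id _) (fun a => by simp [freeMul_of_of]) x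
      mul_one := fun x => Free.isHom_ext (f := fun x => freeMul x (Free.of []))
        (isHom_freeMul_right _) (isHom_id _) (fun a => by simp [freeMul_of_of]) x }
  isHom_mul_left := isHom_freeMul_left h𝒱
  isHom_mul_right := isHom_freeMul_right

end FreeMonoid

/-! ### Predual varieties -/

/-- A pair of predual varieties subject to the standing conditions. -/
structure PredualPair : Type (u + 1) where
  /-- the variety `𝒞` of ordinary algebras -/
  C : Variety.{u}
  /-- the variety `𝒟` of possibly ordered algebras -/
  D : Variety.{u}
  C_unordered : ¬ C.ordered
  C_locallyFinite : C.LocallyFinite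
  D_locallyFinite : D.LocallyFinite
  surjective_of_epi : ∀ {A B : Alg D} (f : A ⟶ B), Epi f → Function.Surjective f
  D_entropic : D.Entropic
  /-- the dual equivalence between finite algebras: its functor is `S` and its inverse is `P` -/
  dual : FinAlg C ≌ (FinAlg D)ᵒᵖ

namespace PredualPair

variable (S : PredualPair.{u})

/-- The free `𝒞`-algebra on one generator. -/
def oneC : FinAlg S.C := ⟨Free S.C PUnit, S.C_locallyFinite _ inferInstance⟩

/-- The free `𝒟`-algebra on one generator. -/
def oneD : FinAlg S.D := ⟨Free S.D PUnit, S.D_locallyFinite _ inferInstance⟩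

/-- The dualising object of `𝒞`, the dual of the free one-generated `𝒟`-algebra. -/
def OC : Alg S.C := (S.dual.inverse.obj (Opposite.op S.oneD)).obj

/-- The dualising object of `𝒟`, the dual of the free one-generated `𝒞`-algebra. -/
def OD : Alg S.D := (S.dual.functor.obj S.oneC).unop.obj

/-- The canonical bijection between the underlying sets of the dualising objects:
`|O_𝒞| ≅ 𝒞(1_𝒞, P 1_𝒟) ≅ 𝒟(1_𝒟, S 1_𝒞) ≅ |O_𝒟|`. -/
def dualEquiv : S.OC ≃ S.OD :=
  (Equiv.funUnique PUnit.{u + 1} S.OC).symm.trans <|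
  (Free.homEquiv PUnit.{u + 1} S.OC).symm.trans <|
  (ObjectProperty.fullyFaithfulι _).homEquiv.symm.trans <|
  (S.dual.toAdjunction.homEquiv S.oneC (Opposite.op S.oneD)).symm.trans <|
  (opEquiv _ _).trans <|
  (ObjectProperty.fullyFaithfulι _).homEquiv.trans <|
  (Free.homEquiv PUnit.{u + 1} S.OD).trans <|
  Equiv.funUnique PUnit.{u + 1} S.OD

end PredualPair

/-! ### Automata in `𝒞` -/

/-- A `Θ`-automaton in `𝒞`: a coalgebra `Q ⟶ O_𝒞 × Q^Θ`, given by the components of its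
structure map. -/
structure Automaton (S : PredualPair.{u}) (Θ : Type u) : Type (u + 1) where
  /-- the object of states -/
  Q : Alg S.C
  /-- the output morphism -/
  out : Q ⟶ S.OC
  /-- the transition morphisms -/
  next : Θ → (Q ⟶ Q)

/-- Coalgebra homomorphisms. -/
@[ext]
structure Automaton.Hom {S : PredualPair.{u}} {Θ : Type u} (A B : Automaton S Θ) : Type u where
  /-- the underlying homomorphism of algebras -/
  hom : A.Q ⟶ B.Q
  out_hom : hom ≫ B.out = A.out
  next_hom : ∀ a, hom ≫ B.next a = A.next a ≫ hom

instance (S : PredualPair.{u}) (Θ : Type u) : Category.{u} (Automaton S Θ) where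
  Hom := Automaton.Hom
  id _ := ⟨𝟙 _, rfl, fun _ => rfl⟩
  comp f g := ⟨f.hom ≫ g.hom, by rw [Category.assoc, g.out_hom, f.out_hom], fun a => by
    rw [Category.assoc, g.next_hom, ← Category.assoc, f.next_hom, Category.assoc]⟩

/-- A set of elements of an algebra that is closed under the operations, as an algebra. -/
def Alg.restrict {𝒱 : Variety.{u}} (A : Alg 𝒱) (s : Set A)
    (hs : ∀ σ x, (∀ i, x i ∈ s) → A.op σ x ∈ s) : Alg 𝒱 where
  carrier := s
  po := Subtype.partialOrder _
  op σ x := ⟨A.op σ fun i => x i, hs σ _ fun i => (x i).2⟩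
  op_mono σ _ _ h := A.op_mono σ h
  discrete hd x y h := Subtype.ext (A.discrete hd x y h)
  sat p hp ρ := by
    have key : ∀ t : Term 𝒱.sig ℕ,
        ((t.eval (A := s) (fun σ x => ⟨A.op σ fun i => x i, hs σ _ fun i => (x i).2⟩) ρ : s) : A)
          = t.eval A.op fun n => ρ n := by
      intro t
      induction t with
      | var n => rfl
      | app σ t ih => exact congrArg (A.op σ) (funext ih)
    rw [← Subtype.coe_le_coe, key, key]
    exact A.sat p hp _

/-- A subautomaton: a subset of states that is closed under the operations of `𝒞` and under the
transitions. -/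
@[ext]
structure SubAutomaton {S : PredualPair.{u}} {Θ : Type u} (A : Automaton S Θ) : Type u where
  /-- the states -/
  carrier : Set A.Q
  op_mem : ∀ σ x, (∀ i, x i ∈ carrier) → A.Q.op σ x ∈ carrier
  next_mem : ∀ a, ∀ q ∈ carrier, A.next a q ∈ carrier

namespace SubAutomaton

variable {S : PredualPair.{u}} {Θ : Type u} {A : Automaton S Θ}

/-- The algebra of states of a subautomaton. -/
def alg (B : SubAutomaton A) : Alg S.C := A.Q.restrict B.carrier B.op_mem

/-- The subautomaton as an automaton. -/
def toAutomaton (B : SubAutomaton A) : Automaton S Θ where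
  Q := B.alg
  out := ⟨fun q => A.out q.1, fun _ _ h => A.out.isHom.mono h, fun σ _ => A.out.isHom.map_op σ _⟩
  next a := ⟨fun q => ⟨A.next a q.1, B.next_mem a _ q.2⟩, fun _ _ h => (A.next a).isHom.mono h,
    fun σ _ => Subtype.ext ((A.next a).isHom.map_op σ _)⟩

/-- The inclusion homomorphism. -/
def incl (B : SubAutomaton A) : B.toAutomaton ⟶ A :=
  ⟨⟨Subtype.val, fun _ _ h => h, fun _ _ => rfl⟩, rfl, fun _ => rfl⟩

/-- The inclusion of a subautomaton into a larger one. -/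
def inclOfLE {B B' : SubAutomaton A} (h : B.carrier ⊆ B'.carrier) :
    B.toAutomaton ⟶ B'.toAutomaton :=
  ⟨⟨Set.inclusion h, fun _ _ h => h, fun _ _ => rfl⟩, rfl, fun _ => rfl⟩

end SubAutomaton

/-- Finite automata in `𝒞`. -/
abbrev FinAutomaton (S : PredualPair.{u}) (Θ : Type u) : Type (u + 1) :=
  ObjectProperty.FullSubcategory fun A : Automaton S Θ => Finite A.Q

/-! ### The rational fixpoint: the automaton of regular languages

From here on `yn` identifies the underlying set of `O_𝒞` with the set of the two truth values. -/

/-- Regular languages over `Θ`. -/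
@[ext]
structure RegLang (Θ : Type u) : Type u where
  /-- the language -/
  lang : Language Θ
  isRegular : lang.IsRegular

namespace RegLang

variable {Θ : Type u}

/-- The left derivative `a⁻¹L`. -/
def leftDeriv (a : Θ) (L : RegLang Θ) : RegLang Θ where
  lang := {w | a :: w ∈ L.lang}
  isRegular := by
    refine Language.IsRegular.of_finite_range_leftQuotient
      (L.isRegular.finite_range_leftQuotient.subset ?_)
    rintro _ ⟨u, rfl⟩
    exact ⟨a :: u, rfl⟩

/-- The right derivative `La⁻¹`. -/
def rightDeriv (a : Θ) (L : RegLang Θ) : RegLang Θ where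
  lang := {w | w ++ [a] ∈ L.lang}
  isRegular := by
    refine Language.IsRegular.of_finite_range_leftQuotient
      ((L.isRegular.finite_range_leftQuotient.image
        fun K : Language Θ => ({w | w ++ [a] ∈ K} : Language Θ)).subset ?_)
    rintro _ ⟨u, rfl⟩
    refine ⟨_, ⟨u, rfl⟩, ?_⟩
    ext w
    change u ++ (w ++ [a]) ∈ L.lang ↔ (u ++ w) ++ [a] ∈ L.lang
    rw [List.append_assoc]

end RegLang

section Reg

variable {S : PredualPair.{u}} (yn : S.OC ≃ Prop) (Θ : Type u)

/-- The operations of `𝒞` on languages, acting on the truth values of `w ∈ L` for each word `w`. -/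
def langOp {Θ : Type u} (σ : S.C.sig.ops) (L : Fin (S.C.sig.arity σ) → Language Θ) :
    Language Θ :=
  {w | yn (S.OC.op σ fun i => yn.symm (w ∈ L i))}

theorem langOp_isRegular {Θ : Type u} (σ : S.C.sig.ops)
    (L : Fin (S.C.sig.arity σ) → Language Θ) (hL : ∀ i, (L i).IsRegular) :
    (langOp yn σ L).IsRegular := by
  refine Language.IsRegular.of_finite_range_leftQuotient
    (((Set.Finite.pi' fun i => (hL i).finite_range_leftQuotient).image (langOp yn σ)).subset ?_)
  rintro _ ⟨u, rfl⟩
  exact ⟨fun i => (L i).leftQuotient u, fun i => ⟨u, rfl⟩, rfl⟩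

theorem langOp_eval {Θ : Type u} {X : Type*} (ρ : X → RegLang Θ) (t : Term S.C.sig X)
    (w : List Θ) :
    yn.symm (w ∈ (t.eval (fun σ L => RegLang.mk (langOp yn σ fun i => (L i).lang)
      (langOp_isRegular yn σ _ fun i => (L i).isRegular)) ρ).lang) =
    t.eval S.OC.op fun x => yn.symm (w ∈ (ρ x).lang) := by
  induction t with
  | var x => rfl
  | app σ t ih =>
    change yn.symm (yn (S.OC.op σ _)) = S.OC.op σ _
    rw [Equiv.symm_apply_apply]
    exact congrArg _ (funext ih)

/-- The regular languages over `Θ` as an algebra of `𝒞`. -/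
def regAlg : Alg S.C where
  carrier := RegLang Θ
  po :=
    { le := Eq
      le_refl := fun _ => rfl
      le_trans := fun _ _ _ => Eq.trans
      le_antisymm := fun _ _ h _ => h }
  op σ L := ⟨langOp yn σ fun i => (L i).lang, langOp_isRegular yn σ _ fun i => (L i).isRegular⟩
  op_mono σ L L' h := congrArg
    (fun L => RegLang.mk (langOp yn σ fun i => (L i).lang)
      (langOp_isRegular yn σ _ fun i => (L i).isRegular)) (show L = L' from funext h)
  discrete _ _ _ h := h
  sat p hp ρ := by
    refine RegLang.ext (Set.ext fun w => iff_of_eq (yn.symm.injective ?_))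
    exact (langOp_eval yn ρ p.1 w).trans ((S.OC.discrete S.C_unordered _ _
      (S.OC.sat p hp _)).trans (langOp_eval yn ρ p.2 w).symm)

/-- The automaton of regular languages: the output of `L` says whether `L` contains the empty
word, and the transitions are the left derivatives. -/
def regAut : Automaton S Θ where
  Q := regAlg yn Θ
  out := ⟨fun L => yn.symm ([] ∈ L.lang),
    fun _ _ h => le_of_eq (congrArg (fun L : RegLang Θ => yn.symm ([] ∈ L.lang)) h),
    fun _ _ => yn.symm_apply_apply _⟩
  next a := ⟨RegLang.leftDeriv a, fun _ _ h => congrArg _ h, fun _ _ => rfl⟩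

end Reg

section RationalFixpoint

variable {S : PredualPair.{u}} (yn : S.OC ≃ Prop) {Θ : Type u}

theorem isHom_of_unordered {A B : Alg S.C} {f : A → B}
    (h : ∀ σ x, f (A.op σ x) = B.op σ fun i => f (x i)) : IsHom f :=
  ⟨fun _ _ hxy => le_of_eq (congrArg f (A.discrete S.C_unordered _ _ hxy)), h⟩

/-- The state reached from `q` by reading a word. -/
def Automaton.run (A : Automaton S Θ) (q : A.Q) : List Θ → A.Q
  | [] => q
  | a :: w => A.run (A.next a q) w

theorem Automaton.run_append (A : Automaton S Θ) (u w : List Θ) (q : A.Q) :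
    A.run q (u ++ w) = A.run (A.run q u) w := by
  induction u generalizing q with
  | nil => rfl
  | cons a u ih => exact ih _

theorem Automaton.run_op (A : Automaton S Θ) (w : List Θ) (σ : S.C.sig.ops)
    (q : Fin (S.C.sig.arity σ) → A.Q) :
    A.run (A.Q.op σ q) w = A.Q.op σ fun i => A.run (q i) w := by
  induction w generalizing q with
  | nil => rfl
  | cons a w ih =>
    change A.run (A.next a _) w = _
    rw [(A.next a).isHom.map_op, ih]; rfl

/-- The language accepted by a state of a finite automaton. -/
def Automaton.behaviour (A : Automaton S Θ) [Finite A.Q] (q : A.Q) : RegLang Θ where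
  lang := {w | yn (A.out (A.run q w))}
  isRegular := by
    refine Language.IsRegular.of_finite_range_leftQuotient ((Set.finite_range
      fun q : A.Q => ({w | yn (A.out (A.run q w))} : Language Θ)).subset ?_)
    rintro _ ⟨u, rfl⟩
    refine ⟨A.run q u, ?_⟩
    ext w
    change yn _ ↔ yn (A.out (A.run q (u ++ w)))
    rw [A.run_append]

/-- The homomorphism from a finite automaton to the automaton of regular languages. -/
def Automaton.toReg (A : Automaton S Θ) [Finite A.Q] : A ⟶ regAut yn Θ where
  hom := ⟨A.behaviour yn, isHom_of_unordered fun σ q => by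
    refine RegLang.ext (Set.ext fun w => iff_of_eq ?_)
    change yn (A.out (A.run (A.Q.op σ q) w)) =
      yn (S.OC.op σ fun i => yn.symm (yn (A.out (A.run (q i) w))))
    simp only [Equiv.symm_apply_apply, A.run_op, A.out.isHom.map_op]⟩
  out_hom := hom_ext fun _ => yn.symm_apply_apply _
  next_hom _ := rfl

theorem Automaton.hom_lang (A : Automaton S Θ) (f : A ⟶ regAut yn Θ) (w : List Θ) (q : A.Q) :
    (w ∈ RegLang.lang (f.hom q)) = yn (A.out (A.run q w)) := by
  induction w generalizing q with
  | nil =>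
    have h : yn.symm ([] ∈ RegLang.lang (f.hom q)) = A.out q :=
      congrArg (fun g : A.Q ⟶ S.OC => g q) f.out_hom
    change _ = yn (A.out q)
    rw [← h, Equiv.apply_symm_apply]
  | cons a w ih =>
    have h : RegLang.leftDeriv a (f.hom q) = f.hom (A.next a q) :=
      congrArg (fun g : A.Q ⟶ regAlg yn Θ => g q) (f.next_hom a)
    change (w ∈ (RegLang.leftDeriv a (f.hom q)).lang) = yn (A.out (A.run (A.next a q) w))
    rw [h, ih]

theorem Automaton.hom_reg_ext {A : Automaton S Θ} (f g : A ⟶ regAut yn Θ) : f = g :=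
  Automaton.Hom.ext (hom_ext fun q => RegLang.ext (Set.ext fun w =>
    iff_of_eq ((A.hom_lang yn f w q).trans (A.hom_lang yn g w q).symm)))

/-- The cocone of the unique homomorphisms from finite automata to the automaton of regular
languages. -/
def regCocone (Θ : Type u) :
    Limits.Cocone (ObjectProperty.ι fun A : Automaton S Θ => Finite A.Q) where
  pt := regAut yn Θ
  ι :=
    { app := fun A => haveI := A.2; A.1.toReg yn
      naturality := fun _ _ _ => Automaton.hom_reg_ext yn _ _ }

theorem exists_finite_subAutomaton (s : Set (regAut yn Θ).Q) (hs : s.Finite) :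
    ∃ B : SubAutomaton (regAut yn Θ), s ⊆ B.carrier ∧ B.carrier.Finite := by
  let R := regAut yn Θ
  let s' : Set R.Q := {q | ∃ L ∈ s, ∃ u, RegLang.lang q = Language.leftQuotient (RegLang.lang L) u}
  have hs' : s'.Finite := by
    have : (⋃ L ∈ s, RegLang.lang ⁻¹' Set.range (Language.leftQuotient (RegLang.lang L))).Finite :=
      hs.biUnion fun L _ => (RegLang.isRegular L).finite_range_leftQuotient.preimage
        fun _ _ _ _ h => RegLang.ext h
    refine this.subset ?_
    rintro q ⟨L, hL, u, h⟩
    exact Set.mem_biUnion hL ⟨u, h.symm⟩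
  have := hs'.to_subtype
  have hfin : Finite (Free S.C s') := S.C_locallyFinite _ inferInstance
  have hn : ∀ a, ∀ q ∈ s', R.next a q ∈ s' := by
    rintro a q ⟨L, hL, u, h⟩
    refine ⟨L, hL, u ++ [a], ?_⟩
    rw [Language.leftQuotient_append, ← h]; rfl
  let l : Free S.C s' ⟶ R.Q := Free.lift Subtype.val
  refine ⟨⟨Set.range l, ?_, ?_⟩, ?_, Set.finite_range _⟩
  · intro σ x hx
    choose y hy using hx
    exact ⟨(Free S.C s').op σ y, by rw [l.isHom.map_op]; exact congrArg _ (funext hy)⟩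
  · rintro a _ ⟨y, rfl⟩
    have : l ≫ R.next a = Free.lift (fun q : s' => Free.of ⟨R.next a q, hn a _ q.2⟩) ≫ l :=
      Free.hom_ext fun q => by simp [l]
    exact ⟨_, (congrArg (fun f : Free S.C s' ⟶ R.Q => f y) this).symm⟩
  · intro L hL
    exact ⟨Free.of ⟨L, L, hL, [], rfl⟩, Free.lift_of _ _⟩

/-- The automaton of regular languages is the rational fixpoint, the colimit of all finite
automata. -/
theorem regCocone_isColimit (Θ : Type u) : Nonempty (Limits.IsColimit (regCocone yn Θ)) := by
  let R := regAut yn Θ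
  let F : ∀ B : SubAutomaton R, B.carrier.Finite → FinAutomaton S Θ :=
    fun B hB => ⟨B.toAutomaton, hB.to_subtype⟩
  choose B hB hfin using fun L : R.Q => exists_finite_subAutomaton yn {L} (Set.finite_singleton L)
  have hι : ∀ (t : Limits.Cocone (ObjectProperty.ι fun A : Automaton S Θ => Finite A.Q))
      {A A' : FinAutomaton S Θ} (f : A ⟶ A') (q : A.1.Q),
      (t.ι.app A').hom (f.hom.hom q) = (t.ι.app A).hom q := fun t A A' f q =>
    congrArg (fun g : A.1 ⟶ t.pt => g.hom q) (t.w f)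
  have hsub : ∀ (t : Limits.Cocone (ObjectProperty.ι fun A : Automaton S Θ => Finite A.Q))
      (B₁ B₂ : SubAutomaton R) (h₁ : B₁.carrier.Finite) (h₂ : B₂.carrier.Finite) (L : R.Q)
      (m₁ : L ∈ B₁.carrier) (m₂ : L ∈ B₂.carrier),
      (t.ι.app (F B₁ h₁)).hom ⟨L, m₁⟩ = (t.ι.app (F B₂ h₂)).hom ⟨L, m₂⟩ := by
    intro t B₁ B₂ h₁ h₂ L m₁ m₂
    obtain ⟨B₃, h, h₃⟩ := exists_finite_subAutomaton yn _ (h₁.union h₂)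
    have e₁ := hι t (A := F B₁ h₁) (A' := F B₃ h₃) (ObjectProperty.homMk
      (SubAutomaton.inclOfLE (Set.subset_union_left.trans h))) ⟨L, m₁⟩
    have e₂ := hι t (A := F B₂ h₂) (A' := F B₃ h₃) (ObjectProperty.homMk
      (SubAutomaton.inclOfLE (Set.subset_union_right.trans h))) ⟨L, m₂⟩
    exact e₁.symm.trans e₂
  let d : ∀ t : Limits.Cocone (ObjectProperty.ι fun A : Automaton S Θ => Finite A.Q),
      R.Q → t.pt.Q := fun t L => (t.ι.app (F (B L) (hfin L))).hom ⟨L, hB L rfl⟩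
  have hd : ∀ t (B₁ : SubAutomaton R) (h₁ : B₁.carrier.Finite) (L : R.Q) (m₁ : L ∈ B₁.carrier),
      d t L = (t.ι.app (F B₁ h₁)).hom ⟨L, m₁⟩ := fun t B₁ h₁ L m₁ =>
    hsub t (B L) B₁ (hfin L) h₁ L _ m₁
  refine ⟨⟨fun t => ⟨⟨d t, isHom_of_unordered fun σ x => ?_⟩, ?_, fun a => ?_⟩, ?_, ?_⟩⟩
  · obtain ⟨B₁, h, h₁⟩ := exists_finite_subAutomaton yn _ (Set.finite_range x)
    have hx : ∀ i, x i ∈ B₁.carrier := fun i => h ⟨i, rfl⟩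
    refine (hd t B₁ h₁ _ (B₁.op_mem σ x hx)).trans (Eq.trans
      ((t.ι.app (F B₁ h₁)).hom.isHom.map_op σ fun i => ⟨x i, hx i⟩) ?_)
    exact congrArg (t.pt.Q.op σ) (funext fun i => (hd t B₁ h₁ _ (hx i)).symm)
  · exact hom_ext fun L => congrArg (fun g : (F (B L) (hfin L)).1.Q ⟶ S.OC => g ⟨L, hB L rfl⟩)
      (t.ι.app (F (B L) (hfin L))).out_hom
  · refine hom_ext fun L => ?_
    have e := congrArg (fun g : (F (B L) (hfin L)).1.Q ⟶ t.pt.Q => g ⟨L, hB L rfl⟩)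
      ((t.ι.app (F (B L) (hfin L))).next_hom a)
    exact Eq.trans e (hd t (B L) (hfin L) _ ((B L).next_mem a _ (hB L rfl))).symm
  · intro t A
    refine Automaton.Hom.ext (hom_ext fun q => ?_)
    have := A.2
    let f := A.1.toReg yn
    let I : SubAutomaton R := ⟨Set.range f.hom, fun σ x hx => by
        choose y hy using hx
        exact ⟨A.1.Q.op σ y, by rw [f.hom.isHom.map_op]; exact congrArg _ (funext hy)⟩,
      fun a L hL => by
        obtain ⟨y, rfl⟩ := hL
        exact ⟨A.1.next a y, (congrArg (fun g : A.1.Q ⟶ R.Q => g y) (f.next_hom a)).symm⟩⟩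
    let g : A.1 ⟶ I.toAutomaton :=
      ⟨⟨fun q => ⟨f.hom q, q, rfl⟩, isHom_of_unordered fun σ x =>
        Subtype.ext (f.hom.isHom.map_op σ x)⟩,
        hom_ext fun q => congrArg (fun g : A.1.Q ⟶ S.OC => g q) f.out_hom,
        fun a => hom_ext fun q => Subtype.ext
          (congrArg (fun g : A.1.Q ⟶ R.Q => g q) (f.next_hom a))⟩
    have e := hι t (A := A) (A' := F I (Set.finite_range _)) (ObjectProperty.homMk g) q
    exact Eq.trans (hd t I (Set.finite_range _) _ ⟨q, rfl⟩) e
  · intro t m hm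
    refine Automaton.Hom.ext (hom_ext fun L => ?_)
    have e := congrArg (fun g : (F (B L) (hfin L)).1 ⟶ t.pt => g.hom ⟨L, hB L rfl⟩)
      (hm (F (B L) (hfin L)))
    have e' : (regCocone yn Θ).ι.app (F (B L) (hfin L)) = (B L).incl :=
      Automaton.hom_reg_ext yn _ _
    rw [e'] at e
    exact e

end RationalFixpoint

/-! ### Local varieties of languages -/

/-- A local variety of languages over `Θ` in `𝒞`: a subautomaton of the rational fixpoint that is
closed under right derivatives. -/
@[ext]
structure LocalVariety {S : PredualPair.{u}} (yn : S.OC ≃ Prop) (Θ : Type u) : Type u extends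
    SubAutomaton (regAut yn Θ) where
  rightDeriv_mem : ∀ a, ∀ L ∈ carrier, RegLang.rightDeriv a L ∈ carrier

/-- The free `𝒟`-monoid on an alphabet. -/
abbrev PredualPair.freeMon (S : PredualPair.{u}) (Θ : Type u) : VMon S.D :=
  freeVMon S.D_entropic Θ

section Preimage

variable {S : PredualPair.{u}} (yn : S.OC ≃ Prop) {Θ Δ E : Type u}

/-- A language over `Δ` as a morphism from the free `𝒟`-monoid on `Δ` to `O_𝒟`: the homomorphic
extension of its characteristic function. -/
def langHom (L : Language Δ) : (S.freeMon Δ).alg ⟶ S.OD :=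
  Free.lift fun w => S.dualEquiv (yn.symm (w ∈ L))

/-- The language identified with a morphism from the free `𝒟`-monoid to `O_𝒟`. -/
def homLang (m : (S.freeMon Θ).alg ⟶ S.OD) : Language Θ :=
  {w | yn (S.dualEquiv.symm (m (Free.of w)))}

/-- The preimage of a language under a morphism between free `𝒟`-monoids. -/
def preimage (f : S.freeMon Θ ⟶ S.freeMon Δ) (L : Language Δ) : Language Θ :=
  homLang yn (f.hom ≫ langHom yn L)

theorem homLang_langHom (L : Language Δ) : homLang yn (langHom yn L) = L := by
  refine Set.ext fun w => iff_of_eq ?_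
  change yn (S.dualEquiv.symm ((Free.lift _ : Free S.D (List Δ) ⟶ S.OD) (Free.of w))) = (w ∈ L)
  rw [Free.lift_of, Equiv.symm_apply_apply, Equiv.apply_symm_apply]

theorem langHom_homLang (m : (S.freeMon Θ).alg ⟶ S.OD) : langHom yn (homLang yn m) = m := by
  refine Free.hom_ext fun w => ?_
  refine (Free.lift_of _ _).trans ?_
  change S.dualEquiv (yn.symm (yn (S.dualEquiv.symm (m (Free.of w))))) = _
  rw [Equiv.symm_apply_apply, Equiv.apply_symm_apply]

theorem preimage_id (L : Language Δ) : preimage yn (𝟙 (S.freeMon Δ)) L = L :=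
  homLang_langHom yn L

theorem preimage_comp (f : S.freeMon Θ ⟶ S.freeMon Δ) (g : S.freeMon Δ ⟶ S.freeMon E)
    (L : Language E) : preimage yn (f ≫ g) L = preimage yn f (preimage yn g L) := by
  rw [preimage, preimage, preimage, langHom_homLang]
  rfl

/-- `V` is closed under `f`-preimages of languages in `W`: taking preimages restricts to a
homomorphism of `𝒞`-algebras from `W` to `V`. -/
def ClosedUnderPreimages (f : S.freeMon Θ ⟶ S.freeMon Δ) (V : LocalVariety yn Θ)
    (W : LocalVariety yn Δ) : Prop :=
  ∃ h : W.alg ⟶ V.alg, ∀ L : W.carrier, (h L).1.lang = preimage yn f L.1.lang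

end Preimage

/-! ### Local pseudovarieties of `𝒟`-monoids -/

/-- A finite `Θ`-generated `𝒟`-monoid: a finite quotient of the free `𝒟`-monoid on `Θ`. -/
structure FinQuot (S : PredualPair.{u}) (Θ : Type u) : Type (u + 1) where
  /-- the quotient monoid -/
  M : VMon S.D
  finite : Finite M.alg
  /-- the quotient morphism -/
  e : S.freeMon Θ ⟶ M
  surjective : Function.Surjective e.hom

/-- `M ≤ N` if there is a morphism from `N` to `M` compatible with the quotient morphisms. -/
instance (S : PredualPair.{u}) (Θ : Type u) : Preorder (FinQuot S Θ) where
  le M N := ∃ f : N.M ⟶ M.M, M.e = N.e ≫ f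
  le_refl M := ⟨𝟙 _, (Category.comp_id _).symm⟩
  le_trans _ _ _ := fun ⟨f, hf⟩ ⟨g, hg⟩ => ⟨g ≫ f, by rw [hf, hg, Category.assoc]⟩

/-- The poset of isomorphism classes of finite `Θ`-generated `𝒟`-monoids. -/
abbrev Quo (S : PredualPair.{u}) (Θ : Type u) : Type (u + 1) :=
  Antisymmetrization (FinQuot S Θ) (· ≤ ·)

/-- The isomorphism class of a finite `Θ`-generated `𝒟`-monoid. -/
def FinQuot.cls {S : PredualPair.{u}} {Θ : Type u} (M : FinQuot S Θ) : Quo S Θ :=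
  toAntisymmetrization (· ≤ ·) M

/-- A local pseudovariety of `𝒟`-monoids over `Θ`: an ideal in the poset of finite `Θ`-generated
`𝒟`-monoids. -/
abbrev LocalPseudovariety (S : PredualPair.{u}) (Θ : Type u) : Type (u + 1) :=
  Order.Ideal (Quo S Θ)

/-! ### The two categories over the category of finitely generated free `𝒟`-monoids -/

/-- The category of finitely generated free `𝒟`-monoids. Its objects are finite sets, and its
morphisms are the `𝒟`-monoid morphisms between the free `𝒟`-monoids on them. -/
structure FreeMonD (S : PredualPair.{u}) : Type (u + 1) where
  /-- the alphabet -/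
  alphabet : Type u
  finite : Finite alphabet

instance (S : PredualPair.{u}) : Category.{u} (FreeMonD S) where
  Hom Θ Δ := S.freeMon Θ.alphabet ⟶ S.freeMon Δ.alphabet
  id Θ := 𝟙 (S.freeMon Θ.alphabet)
  comp {Θ Δ E} (f : S.freeMon Θ.alphabet ⟶ S.freeMon Δ.alphabet)
    (g : S.freeMon Δ.alphabet ⟶ S.freeMon E.alphabet) := f ≫ g

/-- The category of local varieties of languages in `𝒞`: pairs of a finite alphabet and a local
variety of languages over it. -/
structure FLang {S : PredualPair.{u}} (yn : S.OC ≃ Prop) : Type (u + 1) where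
  /-- the alphabet -/
  base : FreeMonD S
  /-- the local variety -/
  V : LocalVariety yn base.alphabet

/-- Morphisms of local varieties of languages: morphisms of the base for which the source is closed
under preimages of languages in the target. -/
@[ext]
structure FLang.Hom {S : PredualPair.{u}} {yn : S.OC ≃ Prop} (X Y : FLang yn) : Type u where
  /-- the underlying morphism of the base -/
  hom : X.base ⟶ Y.base
  closed : ClosedUnderPreimages yn hom X.V Y.V

instance {S : PredualPair.{u}} (yn : S.OC ≃ Prop) : Category.{u} (FLang yn) where
  Hom := FLang.Hom
  id X := ⟨𝟙 X.base, 𝟙 X.V.alg, fun L => (preimage_id yn L.1.lang).symm⟩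
  comp f g := ⟨f.hom ≫ g.hom, by
    obtain ⟨h, hh⟩ := f.closed
    obtain ⟨k, hk⟩ := g.closed
    exact ⟨k ≫ h, fun L => (hh (k L)).trans
      ((congrArg _ (hk L)).trans (preimage_comp yn f.hom g.hom L.1.lang).symm)⟩⟩

/-- The projection of local varieties of languages to their alphabets. -/
def FLang.p {S : PredualPair.{u}} (yn : S.OC ≃ Prop) : FLang yn ⥤ FreeMonD S where
  obj X := X.base
  map f := f.hom

/-- The category of local pseudovarieties of `𝒟`-monoids: pairs of a finite alphabet and a local
pseudovariety over it. -/
structure FVar (S : PredualPair.{u}) : Type (u + 1) where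
  /-- the alphabet -/
  base : FreeMonD S
  /-- the local pseudovariety -/
  P : LocalPseudovariety S base.alphabet

/-- Morphisms `f` of local pseudovarieties: for every `N` in the target there are `M` in the source
and a `𝒟`-monoid morphism `g : M ⟶ N` such that the square formed by `f`, `g` and the quotient
morphisms commutes. -/
@[ext]
structure FVar.Hom {S : PredualPair.{u}} (X Y : FVar S) : Type u where
  /-- the underlying morphism of the base -/
  hom : X.base ⟶ Y.base
  lifts : ∀ N : FinQuot S Y.base.alphabet, N.cls ∈ Y.P →
    ∃ M : FinQuot S X.base.alphabet, M.cls ∈ X.P ∧ ∃ g : M.M ⟶ N.M,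
      CommSq (C := VMon S.D) hom M.e N.e g

instance (S : PredualPair.{u}) : Category.{u} (FVar S) where
  Hom := FVar.Hom
  id X := ⟨𝟙 X.base, fun N hN => ⟨N, hN, 𝟙 _, ⟨(Category.id_comp N.e).trans (Category.comp_id N.e).symm⟩⟩⟩
  comp f g := ⟨f.hom ≫ g.hom, fun N hN => by
    obtain ⟨M, hM, k, hk⟩ := g.lifts N hN
    obtain ⟨K, hK, l, hl⟩ := f.lifts M hM
    exact ⟨K, hK, l ≫ k, hl.horiz_comp hk⟩⟩

/-- The projection of local pseudovarieties to their alphabets. -/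
def FVar.q (S : PredualPair.{u}) : FVar S ⥤ FreeMonD S where
  obj X := X.base
  map f := f.hom

/-- An opfibration: every morphism out of `p X` has an opcartesian lifting starting at `X`. -/
def IsOpfibration {ℰ ℬ : Type*} [Category* ℰ] [Category* ℬ] (p : ℰ ⥤ ℬ) : Prop :=
  ∀ (X : ℰ) (J : ℬ) (w : p.obj X ⟶ J), ∃ (Y : ℰ) (f : X ⟶ Y), p.IsStronglyCocartesian w f

end EilenbergFib

end

noncomputable section

namespace EilenbergFib

/-! ### Finitely generated subalgebras and generators -/

section Generators

variable {𝒱 : Variety.{u}}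

/-! At the finite level the theorem is duality. For a finite quotient `e : ΨΣ* ↠ M`, an element of
the dual `P M` is the same thing as a `𝒟`-morphism `M ⟶ O_𝒟`, that is, a language recognised by `M`.
A word `w` gives a point `1_𝒟 ⟶ M`, whose dual `P M ⟶ O_𝒞` decides membership of `w`. Translations
of `M` by letters dualise to derivatives, so the recognised languages form a finite local variety.
Conversely a finite local variety `B` is isomorphic to some `P A`. Membership of `w` is a
homomorphism `B ⟶ O_𝒞`, hence the dual of a point of `A`, and these points extend to `e : ΨΣ* ⟶ A`.
Since words separate the languages in `B`, the inclusion of the range of `e` has an injective dual,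
so `e` is onto because epimorphisms are surjective. The derivatives of `B` dualise to translations
of `A`, through which `A` inherits a monoid structure (`LocalVariety.exists_recognised_eq`).
Moreover `f ≫ e_N` factors through `e_M` as soon as `M` recognises the `f`-preimages of all
languages recognised by `N` (`FinQuot.exists_hom_of_preimage_mem`); for `f = 𝟙` this says that
inclusion of recognised sets is the order on quotients.

Passing to ideals gives the general case. A regular language has finitely many two-sided quotients
and `𝒞` is locally finite, so every local variety is a directed union of finite ones
(`LocalVariety.exists_finite`). Local varieties therefore correspond to ideals of finite quotients,
and the two conditions on morphisms correspond by `closedUnderPreimages_iff`.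

The opcartesian lift on the monoid side is the pushforward ideal, which consists of all `N` such
that `w ≫ e_N` factors through a member of `P`. Its universal property is image factorisation
(`Lifts.of_comp`). The lift on the language side is obtained by transport. -/

/-- The homomorphism from the free algebra on one generator that picks out an element. -/
def point {A : Alg 𝒱} (x : A) : Free 𝒱 PUnit.{u + 1} ⟶ A := Free.lift fun _ => x

@[simp] theorem point_of {A : Alg 𝒱} (x : A) (t : PUnit.{u + 1}) : point x (Free.of t) = x :=
  Free.lift_of _ _

theorem eq_point {A : Alg 𝒱} (f : Free 𝒱 PUnit.{u + 1} ⟶ A) : f = point (f (Free.of ⟨⟩)) :=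
  Free.hom_ext fun _ => (point_of _ _).symm

theorem point_comp {A B : Alg 𝒱} (x : A) (f : A ⟶ B) : point x ≫ f = point (f x) :=
  Free.hom_ext fun _ => by simp

/-- The range of a homomorphism, as an algebra with the induced order. -/
def Alg.Hom.range {A B : Alg 𝒱} (f : A ⟶ B) : Alg 𝒱 :=
  B.restrict (Set.range f) fun σ x hx => by
    choose y hy using hx
    exact ⟨A.op σ y, by rw [f.isHom.map_op]; exact congrArg _ (funext hy)⟩

/-- The inclusion of a subalgebra. -/
def Alg.restrictIncl (A : Alg 𝒱) (s : Set A) (hs : ∀ σ x, (∀ i, x i ∈ s) → A.op σ x ∈ s) :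
    A.restrict s hs ⟶ A :=
  ⟨Subtype.val, fun _ _ h => h, fun _ _ => rfl⟩

/-- The inclusion of the range of a homomorphism. -/
def Alg.Hom.rangeIncl {A B : Alg 𝒱} (f : A ⟶ B) : Alg.Hom.range f ⟶ B := B.restrictIncl _ _

/-- The corestriction of a homomorphism to a subalgebra. -/
def Alg.restrictLift {A B : Alg 𝒱} (f : B ⟶ A) (s : Set A)
    (hs : ∀ σ x, (∀ i, x i ∈ s) → A.op σ x ∈ s) (h : ∀ x, f x ∈ s) : B ⟶ A.restrict s hs :=
  ⟨fun x => ⟨f x, h x⟩, fun _ _ h => f.isHom.mono h, fun σ x => Subtype.ext (f.isHom.map_op σ x)⟩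

/-- The corestriction of a homomorphism to the range of another one. -/
def Alg.Hom.rangeLift {A B E : Alg 𝒱} (f : A ⟶ B) (g : E ⟶ B) (h : ∀ x, g x ∈ Set.range f) :
    E ⟶ Alg.Hom.range f := Alg.restrictLift g _ _ h

/-- The two images together generate a finite subalgebra. This reduces cancellation against
arbitrary codomains to finite ones, where the duality applies. -/
theorem Variety.LocallyFinite.exists_finite_factor (h𝒱 : 𝒱.LocallyFinite) {A E : Alg 𝒱}
    [Finite A] (g h : A ⟶ E) : ∃ (F : Alg 𝒱) (_ : Finite F) (g' h' : A ⟶ F) (i : F ⟶ E),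
      Function.Injective i ∧ g' ≫ i = g ∧ h' ≫ i = h := by
  let l : Free 𝒱 (A ⊕ A) ⟶ E := Free.lift (Sum.elim g h)
  have : Finite (Free 𝒱 (A ⊕ A)) := h𝒱 _ inferInstance
  exact ⟨Alg.Hom.range l, (Set.finite_range l).to_subtype,
    Alg.Hom.rangeLift l g fun x => ⟨Free.of (.inl x), Free.lift_of _ _⟩,
    Alg.Hom.rangeLift l h fun x => ⟨Free.of (.inr x), Free.lift_of _ _⟩,
    Alg.Hom.rangeIncl l, Subtype.val_injective, rfl, rfl⟩

end Generators

/-! ### The pairing between a finite algebra and its dual -/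

namespace PredualPair

variable {S : PredualPair.{u}}

/-- The dual of a finite `𝒟`-algebra. -/
def dualObj (A : FinAlg S.D) : FinAlg S.C := S.dual.inverse.obj (Opposite.op A)

/-- The dual of a homomorphism between finite `𝒟`-algebras. -/
def dualMap {A B : FinAlg S.D} (f : A.obj ⟶ B.obj) : (dualObj B).obj ⟶ (dualObj A).obj :=
  (S.dual.inverse.map (ObjectProperty.homMk f).op).hom

theorem dualMap_comp {A B E : FinAlg S.D} (f : A.obj ⟶ B.obj) (g : B.obj ⟶ E.obj) :
    dualMap (f ≫ g) = dualMap g ≫ dualMap f :=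
  congrArg (fun h => h.hom) (S.dual.inverse.map_comp (ObjectProperty.homMk (Y := E) g).op
    (ObjectProperty.homMk (Y := B) f).op)

theorem dualMap_injective {A B : FinAlg S.D} {f g : A.obj ⟶ B.obj} (h : dualMap f = dualMap g) :
    f = g := by
  have h' := S.dual.inverse.map_injective (ObjectProperty.hom_ext _ h)
  exact congrArg (fun h => h.unop.hom) h'

theorem dualMap_surjective {A B : FinAlg S.D} (g : (dualObj B).obj ⟶ (dualObj A).obj) :
    ∃ f : A.obj ⟶ B.obj, dualMap f = g := by
  obtain ⟨f, hf⟩ := S.dual.inverse.map_surjective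
    (X := Opposite.op B) (Y := Opposite.op A) (ObjectProperty.homMk g)
  exact ⟨f.unop.hom, congrArg (fun h => h.hom) hf⟩

/-- Evaluation at an element of a finite `𝒟`-algebra, the dual of the homomorphism from the free
algebra that picks out the element. -/
def ev {A : FinAlg S.D} (x : A.obj) : (dualObj A).obj ⟶ S.OC :=
  dualMap (A := S.oneD) (point x)

/-- Naturality of evaluation: the dual functor is contravariant, and `point (f x)` is `point x ≫ f`.
-/
theorem ev_map {A B : FinAlg S.D} (f : A.obj ⟶ B.obj) (x : A.obj) (p : (dualObj B).obj) :
    ev (f x) p = ev x (dualMap f p) := by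
  have h : dualMap (A := S.oneD) (point (f x)) = dualMap f ≫ dualMap (A := S.oneD) (point x) :=
    (congrArg (dualMap (A := S.oneD)) (point_comp x f).symm).trans
      (dualMap_comp (A := S.oneD) (point x) f)
  exact congrArg (fun k : (dualObj B).obj ⟶ S.OC => k p) h

/-- Faithfulness of the dual functor on points `1_𝒟 ⟶ A`; the next lemma is fullness. -/
theorem eq_of_ev_eq {A : FinAlg S.D} {x y : A.obj} (h : ∀ p, ev x p = ev y p) : x = y := by
  have := dualMap_injective (A := S.oneD) (hom_ext h)
  rw [← point_of x ⟨⟩, this, point_of]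

theorem exists_ev_eq {A : FinAlg S.D} (g : (dualObj A).obj ⟶ S.OC) : ∃ x : A.obj, ev x = g := by
  obtain ⟨f, rfl⟩ := dualMap_surjective (A := S.oneD) g
  exact ⟨f (Free.of ⟨⟩), congrArg (dualMap (A := S.oneD)) (eq_point f).symm⟩

/-- The elements of the dual of a finite `𝒟`-algebra as homomorphisms to `O_𝒟`. -/
def charEquiv (A : FinAlg S.D) : (dualObj A).obj ≃ (A.obj ⟶ S.OD) :=
  (Equiv.funUnique PUnit.{u + 1} (dualObj A).obj).symm.trans <|
  (Free.homEquiv PUnit.{u + 1} (dualObj A).obj).symm.trans <|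
  (ObjectProperty.fullyFaithfulι _).homEquiv.symm.trans <|
  (S.dual.toAdjunction.homEquiv S.oneC (Opposite.op A)).symm.trans <|
  (opEquiv _ _).trans
  (ObjectProperty.fullyFaithfulι _).homEquiv

/-- The identification of the two dualising objects is the chain defining `charEquiv` at `1_𝒟`,
followed by evaluation at the generator. -/
theorem dualEquiv_eq (q : S.OC) : S.dualEquiv q = charEquiv S.oneD q (Free.of ⟨⟩) := rfl

/-- Naturality of the hom-bijection of the adjunction, with `p` regarded as a morphism out of `1_𝒞`.
-/
theorem charEquiv_map {A B : FinAlg S.D} (f : A.obj ⟶ B.obj) (p : (dualObj B).obj) :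
    charEquiv A (dualMap f p) = f ≫ charEquiv B p := by
  have h : (ObjectProperty.homMk (point (dualMap f p)) : S.oneC ⟶ dualObj A) =
      ObjectProperty.homMk (Y := dualObj B) (point p) ≫
        S.dual.inverse.map (ObjectProperty.homMk (Y := B) f).op :=
    ObjectProperty.hom_ext _ (point_comp p (dualMap f)).symm
  have h' := congrArg (fun k => k.unop.hom) ((congrArg
    (S.dual.toAdjunction.homEquiv S.oneC (Opposite.op A)).symm h).trans
    (S.dual.toAdjunction.homEquiv_naturality_right_symm (X := S.oneC) (ObjectProperty.homMk (Y := dualObj B) (point p))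
      (ObjectProperty.homMk (Y := B) f).op))
  exact h'

/-- Links the two views of `p`, as a character of `A` and as an argument of evaluations: apply
naturality to `point x`, then evaluate at the generator. -/
theorem charEquiv_apply {A : FinAlg S.D} (p : (dualObj A).obj) (x : A.obj) :
    charEquiv A p x = S.dualEquiv (ev x p) := by
  rw [dualEquiv_eq, ev]
  refine Eq.trans ?_ (congrArg (fun k : Free S.D _ ⟶ S.OD => k (Free.of ⟨⟩))
    (charEquiv_map (A := S.oneD) (point x) p)).symm
  change _ = charEquiv A p (point x (Free.of ⟨⟩))
  rw [point_of]

/-- An injective dual is left-cancellable data for `f`: by faithfulness `f` is epic against finite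
codomains, hence epic, hence surjective. -/
theorem surjective_of_dual_injective {A B : FinAlg S.D} (f : A.obj ⟶ B.obj)
    (hf : Function.Injective (dualMap f)) : Function.Surjective f := by
  refine S.surjective_of_epi f ⟨fun {E} g h hgh => ?_⟩
  have := B.2
  -- `E` may be infinite and then has no dual, so both morphisms are first factored through a finite
  -- algebra.
  obtain ⟨F, hF, g', h', i, hi, rfl, rfl⟩ := S.D_locallyFinite.exists_finite_factor g h
  have e : f ≫ g' = f ≫ h' := hom_ext fun x => hi (congrArg (fun k : A.obj ⟶ E => k x) hgh)
  have e' := congrArg (dualMap (B := ⟨F, hF⟩)) e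
  rw [dualMap_comp (E := ⟨F, hF⟩), dualMap_comp (E := ⟨F, hF⟩)] at e'
  have : g' = h' := dualMap_injective (B := ⟨F, hF⟩)
    (hom_ext fun p => hf (congrArg (fun k : _ ⟶ (dualObj A).obj => k p) e'))
  rw [this]

theorem exists_dual_equiv (W : Alg S.C) [hW : Finite W] :
    ∃ A : FinAlg S.D, Nonempty ((dualObj A).obj ≅ W) :=
  ⟨(S.dual.functor.obj ⟨W, hW⟩).unop,
    ⟨(ObjectProperty.ι _).mapIso (S.dual.unitIso.app ⟨W, hW⟩).symm⟩⟩

end PredualPair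

open PredualPair

/-! ### Languages recognised by a finite quotient of the free monoid -/

/-- The insertion of words into the free `𝒟`-monoid. -/
def ofWord (S : PredualPair.{u}) {Θ : Type u} (w : List Θ) : (S.freeMon Θ).alg := Free.of w

namespace FinQuot

variable {S : PredualPair.{u}} (yn : S.OC ≃ Prop) {Θ Δ : Type u}

/-- The underlying finite algebra. -/
abbrev finAlg (M : FinQuot S Θ) : FinAlg S.D := ⟨M.M.alg, M.finite⟩

/-- The value of the quotient morphism at a word. -/
def word (M : FinQuot S Θ) (w : List Θ) : M.M.alg := M.e.hom (ofWord S w)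

theorem word_append (M : FinQuot S Θ) (u w : List Θ) :
    M.word (u ++ w) = M.word u * M.word w := by
  refine Eq.trans ?_ (M.e.map_mul (ofWord S u) (ofWord S w))
  exact congrArg M.e.hom (freeMul_of_of u w).symm

/-- Left multiplication by an element. -/
def mulLeft (M : FinQuot S Θ) (x : M.M.alg) : M.finAlg.obj ⟶ M.finAlg.obj :=
  ⟨fun y => (x * y : M.M.alg), M.M.isHom_mul_left x⟩

/-- Right multiplication by an element. -/
def mulRight (M : FinQuot S Θ) (y : M.M.alg) : M.finAlg.obj ⟶ M.finAlg.obj :=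
  ⟨fun x => (x * y : M.M.alg), M.M.isHom_mul_right y⟩

/-- The language recognised by a finite quotient monoid via an element of its dual. -/
def recLang (M : FinQuot S Θ) (p : (dualObj M.finAlg).obj) : RegLang Θ where
  lang := {w | yn (ev (A := M.finAlg) (M.word w) p)}
  isRegular := by
    have := M.finAlg.2
    -- The left quotient by `u` depends only on `M.word u`, one of finitely many elements.
    refine Language.IsRegular.of_finite_range_leftQuotient ((Set.finite_range
      fun x : M.finAlg.obj =>
        ({w | yn (ev (A := M.finAlg) (M.word w) (dualMap (M.mulLeft x) p))} : Language Θ)).subset ?_)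
    rintro _ ⟨u, rfl⟩
    refine ⟨M.word u, Set.ext fun w => iff_of_eq ?_⟩
    change yn _ = yn (ev (A := M.finAlg) (M.word (u ++ w)) p)
    rw [word_append, ← ev_map]; rfl

/-- The homomorphism that sends an element of the dual of a finite quotient monoid to the language
that it recognises. -/
def recHom (M : FinQuot S Θ) : (dualObj M.finAlg).obj ⟶ regAlg yn Θ :=
  ⟨M.recLang yn, isHom_of_unordered fun σ p => by
    refine RegLang.ext (Set.ext fun w => iff_of_eq ?_)
    change yn (ev (A := M.finAlg) (M.word w) _) = yn (S.OC.op σ fun i => yn.symm (yn (ev (A := M.finAlg) (M.word w) (p i))))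
    simp only [Equiv.symm_apply_apply, (ev (A := M.finAlg) (M.word w)).isHom.map_op]⟩

/-- The languages recognised by a finite quotient monoid. -/
def recognised (M : FinQuot S Θ) : Set (RegLang Θ) := Set.range (M.recLang yn)

theorem langHom_recLang (M : FinQuot S Θ) (p : (dualObj M.finAlg).obj) :
    langHom yn (M.recLang yn p).lang = M.e.hom ≫ charEquiv M.finAlg p := by
  refine Free.hom_ext fun w => (Free.lift_of _ _).trans ?_
  change S.dualEquiv (yn.symm (yn _)) = charEquiv M.finAlg p (M.word w)
  rw [charEquiv_apply, Equiv.symm_apply_apply]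

theorem mem_preimage_recLang (f : S.freeMon Θ ⟶ S.freeMon Δ) (N : FinQuot S Δ)
    (p : (dualObj N.finAlg).obj) (w : List Θ) :
    (w ∈ preimage yn f (N.recLang yn p).lang) =
      yn (ev (A := N.finAlg) (N.e.hom (f.hom (ofWord S w))) p) := by
  rw [preimage, langHom_recLang]
  change yn (S.dualEquiv.symm (charEquiv N.finAlg p (N.e.hom (f.hom (ofWord S w))))) = _
  rw [charEquiv_apply, Equiv.symm_apply_apply]

theorem preimage_recLang {f : S.freeMon Θ ⟶ S.freeMon Δ} {M : FinQuot S Θ} {N : FinQuot S Δ}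
    {g : M.M ⟶ N.M} (h : f ≫ N.e = M.e ≫ g) (p : (dualObj N.finAlg).obj) :
    preimage yn f (N.recLang yn p).lang =
      (M.recLang yn (dualMap (A := M.finAlg) (B := N.finAlg) g.hom p)).lang := by
  refine Set.ext fun w => iff_of_eq ((mem_preimage_recLang yn f N p w).trans ?_)
  change _ = yn (ev (A := M.finAlg) (M.word w) _)
  rw [← ev_map (A := M.finAlg) (B := N.finAlg)]
  exact congrArg (fun k : S.freeMon Θ ⟶ N.M =>
    yn (ev (A := N.finAlg) (k.hom (ofWord S w)) p)) h

/-- Words need not exhaust `M`, but they generate it as a `𝒟`-algebra, so they determine a character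
of `M`. -/
theorem ev_ext (M : FinQuot S Θ) {p q : (dualObj M.finAlg).obj}
    (h : ∀ w, ev (A := M.finAlg) (M.word w) p = ev (A := M.finAlg) (M.word w) q) : p = q := by
  refine (charEquiv M.finAlg).injective ?_
  have : M.e.hom ≫ charEquiv M.finAlg p = M.e.hom ≫ charEquiv M.finAlg q :=
    Free.hom_ext fun w => by
      change charEquiv M.finAlg p (M.word w) = charEquiv M.finAlg q (M.word w)
      rw [charEquiv_apply, charEquiv_apply, h]
  refine EilenbergFib.hom_ext fun y => ?_
  obtain ⟨x, rfl⟩ := M.surjective y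
  exact congrArg (fun k : (S.freeMon Θ).alg ⟶ S.OD => k x) this

theorem finite_recognised (M : FinQuot S Θ) : (M.recognised yn).Finite :=
  haveI := (dualObj M.finAlg).2
  Set.finite_range _

/-- The languages recognised by a finite quotient monoid form a local variety. -/
def recVariety (M : FinQuot S Θ) : LocalVariety yn Θ where
  carrier := M.recognised yn
  op_mem σ x hx := by
    choose p hp using hx
    exact ⟨(dualObj M.finAlg).obj.op σ p, ((M.recHom yn).isHom.map_op σ p).trans
      (congrArg ((regAlg yn Θ).op σ) (funext hp))⟩
  next_mem a := by
    rintro _ ⟨p, rfl⟩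
    refine ⟨dualMap (M.mulLeft (M.word [a])) p, RegLang.ext (Set.ext fun w => iff_of_eq ?_)⟩
    change yn _ = yn (ev (A := M.finAlg) (M.word ([a] ++ w)) p)
    rw [word_append, ← ev_map]; rfl
  rightDeriv_mem a := by
    rintro _ ⟨p, rfl⟩
    refine ⟨dualMap (M.mulRight (M.word [a])) p, RegLang.ext (Set.ext fun w => iff_of_eq ?_)⟩
    change yn _ = yn (ev (A := M.finAlg) (M.word (w ++ [a])) p)
    rw [word_append, ← ev_map]; rfl

/-- If the preimages of all languages recognised by `N` are recognised by `M`, then there is a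
compatible monoid morphism from `M` to `N`. -/
theorem exists_hom_of_preimage_mem (f : S.freeMon Θ ⟶ S.freeMon Δ) (M : FinQuot S Θ)
    (N : FinQuot S Δ) (h : ∀ L ∈ N.recognised yn, ∃ K ∈ M.recognised yn, K.lang = preimage yn f L.lang) :
    ∃ g : M.M ⟶ N.M, f ≫ N.e = M.e ≫ g := by
  have h' : ∀ p : (dualObj N.finAlg).obj, ∃ q : (dualObj M.finAlg).obj, ∀ w,
      ev (A := M.finAlg) (M.word w) q = ev (A := N.finAlg) (N.e.hom (f.hom (ofWord S w))) p := by
    intro p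
    obtain ⟨_, ⟨q, rfl⟩, hq⟩ := h _ ⟨p, rfl⟩
    refine ⟨q, fun w => yn.injective ?_⟩
    rw [← mem_preimage_recLang, ← hq]; rfl
  choose j hj using h'
  -- By `ev_ext` the chosen `j p` is the only candidate, and evaluations are homomorphisms, so `j`
  -- preserves the operations.
  have hj' : IsHom j := isHom_of_unordered fun σ p => M.ev_ext fun w => by
    rw [hj, (ev _).isHom.map_op, (ev _).isHom.map_op]
    simp only [hj]
  obtain ⟨g, hg⟩ := dualMap_surjective (A := M.finAlg) (B := N.finAlg) ⟨j, hj'⟩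
  have hg' : f.hom ≫ N.e.hom = M.e.hom ≫ g := Free.hom_ext fun w =>
    eq_of_ev_eq (A := N.finAlg) fun p => by
      refine (hj p w).symm.trans (Eq.trans ?_ (ev_map (A := M.finAlg) (B := N.finAlg) g (M.word w) p).symm)
      rw [hg]
  have hx : ∀ x, g (M.e.hom x) = N.e.hom (f.hom x) := fun x =>
    (congrArg (fun k : (S.freeMon Θ).alg ⟶ N.M.alg => k x) hg').symm
  -- So far `g` is only a morphism of algebras; it is multiplicative because `M.e` is surjective and
  -- the square commutes.
  refine ⟨⟨g, ?_, fun a b => ?_⟩, VMon.Hom.ext hg'⟩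
  · rw [← M.e.map_one]
    refine (hx 1).trans ?_
    rw [f.map_one, N.e.map_one]
  · obtain ⟨x, rfl⟩ := M.surjective a
    obtain ⟨y, rfl⟩ := M.surjective b
    rw [← M.e.map_mul]
    refine (hx _).trans ?_
    rw [f.map_mul, N.e.map_mul]
    exact (congrArg₂ (fun a b : N.M.alg => a * b) (hx x) (hx y)).symm

theorem recognised_mono {M N : FinQuot S Θ} (h : M ≤ N) : M.recognised yn ⊆ N.recognised yn := by
  obtain ⟨g, hg⟩ := h
  rintro _ ⟨p, rfl⟩
  refine ⟨_, RegLang.ext ((preimage_recLang yn (f := 𝟙 _) (g := g) ?_ p).symm.trans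
    (preimage_id yn _))⟩
  rw [Category.id_comp, hg]

theorem recognised_subset_iff {M N : FinQuot S Θ} : M.recognised yn ⊆ N.recognised yn ↔ M ≤ N := by
  refine ⟨fun h => ?_, recognised_mono yn⟩
  obtain ⟨g, hg⟩ := exists_hom_of_preimage_mem yn (𝟙 _) N M fun L hL =>
    ⟨L, h hL, (preimage_id yn L.lang).symm⟩
  exact ⟨g, (Category.id_comp M.e).symm.trans hg⟩

end FinQuot

/-! ### Finite local varieties inside a local variety -/

/-- A regular language has finitely many two-sided quotients by words. -/
theorem finite_twoSidedQuotients {Θ : Type u} {L : Language Θ} (hL : L.IsRegular) :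
    {K : Language Θ | ∃ u v, ∀ w, w ∈ K ↔ u ++ w ++ v ∈ L}.Finite := by
  let R := Set.range L.leftQuotient
  have hR : R.Finite := hL.finite_range_leftQuotient
  -- The two-sided quotient by `u` and `v` is determined by the left quotient by `u` and by the set
  -- `T` of those left quotients of `L` that contain `v`. Both range over finite sets.
  let k : Set (Language Θ) → Language Θ → Language Θ := fun T K =>
    {w | K.leftQuotient w ∈ T}
  refine ((hR.finite_subsets.prod hR).image fun x => k x.1 x.2).subset ?_
  rintro K ⟨u, v, h⟩
  refine ⟨({J ∈ R | v ∈ J}, L.leftQuotient u), ⟨Set.sep_subset _ _, u, rfl⟩, Set.ext fun w => ?_⟩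
  refine Iff.trans ?_ (h w).symm
  change (L.leftQuotient u).leftQuotient w ∈ R ∧ v ∈ (L.leftQuotient u).leftQuotient w ↔ _
  rw [← Language.leftQuotient_append]
  exact ⟨fun h => h.2, fun h => ⟨⟨_, rfl⟩, h⟩⟩

section

variable {S : PredualPair.{u}} {yn : S.OC ≃ Prop} {Θ : Type u}

/-- The right derivative as a homomorphism. -/
def rightDerivHom (yn : S.OC ≃ Prop) (a : Θ) : regAlg yn Θ ⟶ regAlg yn Θ :=
  ⟨RegLang.rightDeriv a, isHom_of_unordered fun _ _ => rfl⟩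

/-- The two-sided quotients of the languages in `s` are finite in number and stable under both
derivatives. As derivatives are `𝒞`-homomorphisms, the subalgebra generated by these quotients is
stable too, and it is finite by local finiteness. -/
theorem LocalVariety.exists_finite (V : LocalVariety yn Θ) (s : Set (RegLang Θ)) (hs : s.Finite)
    (hsV : s ⊆ V.carrier) :
    ∃ B : LocalVariety yn Θ, s ⊆ B.carrier ∧ B.carrier ⊆ V.carrier ∧ B.carrier.Finite := by
  let s' : Set (RegLang Θ) := {K | K ∈ V.carrier ∧ ∃ L ∈ s, ∃ u v, ∀ w,
    w ∈ K.lang ↔ u ++ w ++ v ∈ L.lang}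
  have hs' : s'.Finite := by
    refine ((hs.biUnion fun L _ => (finite_twoSidedQuotients L.isRegular)).preimage
      (f := RegLang.lang) fun _ _ _ _ h => RegLang.ext h).subset ?_
    rintro K ⟨_, L, hL, h⟩
    exact Set.mem_biUnion hL h
  have := hs'.to_subtype
  have hfin : Finite (Free S.C s') := S.C_locallyFinite _ inferInstance
  have hn : ∀ a, ∀ q ∈ s', RegLang.leftDeriv a q ∈ s' := by
    rintro a K ⟨hK, L, hL, u, v, h⟩
    refine ⟨V.next_mem a _ hK, L, hL, u ++ [a], v, fun w => ?_⟩
    change a :: w ∈ K.lang ↔ _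
    rw [h]; simp
  have hr : ∀ a, ∀ q ∈ s', RegLang.rightDeriv a q ∈ s' := by
    rintro a K ⟨hK, L, hL, u, v, h⟩
    refine ⟨V.rightDeriv_mem a _ hK, L, hL, u, a :: v, fun w => ?_⟩
    change w ++ [a] ∈ K.lang ↔ _
    rw [h]; simp
  let l : Free S.C s' ⟶ regAlg yn Θ := Free.lift Subtype.val
  have hd : ∀ (d : regAlg yn Θ ⟶ regAlg yn Θ), (∀ q ∈ s', d q ∈ s') →
      ∀ q ∈ Set.range l, d q ∈ Set.range l := by
    rintro d hd _ ⟨y, rfl⟩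
    let c : s' → Free S.C s' := fun q => Free.of ⟨d q.1, hd q.1 q.2⟩
    have : l ≫ d = Free.lift c ≫ l :=
      Free.hom_ext fun q => (congrArg d (Free.lift_of _ q)).trans
        (((congrArg l (Free.lift_of c q)).trans (Free.lift_of _ _)).symm)
    exact ⟨_, (congrArg (fun f : Free S.C s' ⟶ regAlg yn Θ => f y) this).symm⟩
  -- The same extension taken inside `V`, which shows that the range of `l` stays in `V`.
  let l' : Free S.C s' ⟶ V.alg := Free.lift fun q => ⟨q.1, q.2.1⟩
  have hl : ∀ y, l y = (l' y).1 := by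
    have : l = l' ≫ Alg.restrictIncl _ _ _ := Free.hom_ext fun q => by
      have h : l' (Free.of q) = ⟨q.1, q.2.1⟩ := Free.lift_of _ q
      exact (Free.lift_of _ q).trans (congrArg Subtype.val h).symm
    exact fun y => congrArg (fun f : Free S.C s' ⟶ regAlg yn Θ => f y) this
  refine ⟨⟨⟨Set.range l, fun σ x hx => ?_, fun a => hd ((regAut yn Θ).next a) (hn a)⟩,
    fun a => hd (rightDerivHom yn a) (hr a)⟩, fun L hL => ?_, ?_, Set.finite_range _⟩
  · choose y hy using hx
    exact ⟨(Free S.C s').op σ y, (l.isHom.map_op σ y).trans (congrArg _ (funext hy))⟩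
  · exact ⟨Free.of ⟨L, hsV hL, L, hL, [], [], fun w => by simp⟩, Free.lift_of _ _⟩
  · rintro _ ⟨y, rfl⟩
    rw [hl]
    exact (l' y).2

end

/-! ### Quotients of monoids -/

section Quotient

variable {𝒱 : Variety.{u}}

section

variable (M : VMon 𝒱) {A : Alg 𝒱} (e : M.alg ⟶ A) (he : Function.Surjective e)
  (hl : ∀ x, ∃ l : A → A, IsHom l ∧ ∀ y, l (e y) = e (x * y))
  (hr : ∀ y, ∃ r : A → A, IsHom r ∧ ∀ x, r (e x) = e (x * y))

/-- The product is independent of representatives: `l` allows the right factor to be replaced, then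
`r` the left one. -/
theorem apply_surjInv_mul (M : VMon 𝒱) {A : Alg 𝒱} (e : M.alg ⟶ A)
    (he : Function.Surjective e)
    (hl : ∀ x, ∃ l : A → A, IsHom l ∧ ∀ y, l (e y) = e (x * y))
    (hr : ∀ y, ∃ r : A → A, IsHom r ∧ ∀ x, r (e x) = e (x * y)) (x y : M.alg) :
    e (Function.surjInv he (e x) * Function.surjInv he (e y)) = e (x * y) := by
  obtain ⟨l, -, hl⟩ := hl (Function.surjInv he (e x))
  obtain ⟨r, -, hr⟩ := hr y
  rw [← hl, Function.surjInv_eq he, hl, ← hr, Function.surjInv_eq he, hr]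

/-- The monoid structure on the codomain of a surjective homomorphism for which translations by
elements of the domain induce homomorphisms of the codomain. -/
def VMon.quotient : VMon 𝒱 where
  alg := A
  mon :=
    { mul := fun a b => e (Function.surjInv he a * Function.surjInv he b)
      one := e 1
      mul_assoc := by
        intro a b c
        obtain ⟨x, rfl⟩ := he a
        obtain ⟨y, rfl⟩ := he b
        obtain ⟨z, rfl⟩ := he c
        change e (Function.surjInv he (e _) * _) = e (_ * Function.surjInv he (e _))
        simp only [apply_surjInv_mul M e he hl hr, mul_assoc]
      one_mul := by
        intro a
        obtain ⟨x, rfl⟩ := he a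
        exact (apply_surjInv_mul M e he hl hr 1 x).trans (by rw [one_mul])
      mul_one := by
        intro a
        obtain ⟨x, rfl⟩ := he a
        exact (apply_surjInv_mul M e he hl hr x 1).trans (by rw [mul_one]) }
  isHom_mul_left a := by
    obtain ⟨l, hl, hle⟩ := hl (Function.surjInv he a)
    have : (fun b => e (Function.surjInv he a * Function.surjInv he b)) = l :=
      funext fun b => by rw [← hle, Function.surjInv_eq he]
    exact this ▸ hl
  isHom_mul_right b := by
    obtain ⟨r, hr, hre⟩ := hr (Function.surjInv he b)
    have : (fun a => e (Function.surjInv he a * Function.surjInv he b)) = r :=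
      funext fun a => by rw [← hre, Function.surjInv_eq he]
    exact this ▸ hr

/-- The quotient morphism. -/
def VMon.toQuotient : M ⟶ M.quotient e he hl hr :=
  ⟨e, rfl, fun x y => (apply_surjInv_mul M e he hl hr x y).symm⟩

end

/-- Homomorphisms on the free algebra on the words, given compatible translations by words, have
compatible translations by arbitrary elements. -/
theorem exists_translation_left (h𝒱 : 𝒱.Entropic) {Θ : Type u} {A : Alg 𝒱} (pt : List Θ → A)
    (h : ∀ u, ∃ l : A → A, IsHom l ∧ ∀ w, l (pt w) = pt (u ++ w)) (x : Free 𝒱 (List Θ)) :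
    ∃ l : A → A, IsHom l ∧ ∀ y, l ((Free.lift pt : Free 𝒱 _ ⟶ A) y) =
      (Free.lift pt : Free 𝒱 _ ⟶ A) (freeMul x y) := by
  choose l hl hlp using h
  -- Translation by `x` is the `𝒟`-combination, prescribed by `x`, of the translations by words. In
  -- an entropic variety such a combination of homomorphisms is again a homomorphism.
  have hx : IsHom fun a => (Free.lift (fun u => l u a) : Free 𝒱 _ ⟶ A) x :=
    isHom_eval h𝒱 l hl _
  refine ⟨_, hx, Free.isHom_ext (hx.comp (Free.lift pt).isHom)
    ((Free.lift pt).isHom.comp (isHom_freeMul_left h𝒱 x)) fun w => ?_⟩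
  refine Free.isHom_ext (Free.lift _).isHom
    ((Free.lift pt).isHom.comp (isHom_freeMul_right _)) (fun u => ?_) x
  simp [freeMul_of_of, hlp]

theorem exists_translation_right (h𝒱 : 𝒱.Entropic) {Θ : Type u} {A : Alg 𝒱} (pt : List Θ → A)
    (h : ∀ v, ∃ r : A → A, IsHom r ∧ ∀ w, r (pt w) = pt (w ++ v)) (y : Free 𝒱 (List Θ)) :
    ∃ r : A → A, IsHom r ∧ ∀ x, r ((Free.lift pt : Free 𝒱 _ ⟶ A) x) =
      (Free.lift pt : Free 𝒱 _ ⟶ A) (freeMul x y) := by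
  choose r hr hrp using h
  have hy : IsHom fun a => (Free.lift (fun u => r u a) : Free 𝒱 _ ⟶ A) y :=
    isHom_eval h𝒱 r hr _
  refine ⟨_, hy, Free.isHom_ext (hy.comp (Free.lift pt).isHom)
    ((Free.lift pt).isHom.comp (isHom_freeMul_right y)) fun w => ?_⟩
  refine Free.isHom_ext (Free.lift _).isHom
    ((Free.lift pt).isHom.comp (isHom_freeMul_left h𝒱 _)) (fun u => ?_) y
  simp [freeMul_of_of, hrp]

end Quotient

/-! ### From a finite local variety to a finite quotient monoid -/

section

variable {S : PredualPair.{u}} {yn : S.OC ≃ Prop} {Θ : Type u}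

/-- Every finite local variety consists of the languages recognised by a finite quotient. -/
theorem LocalVariety.exists_recognised_eq (B : LocalVariety yn Θ) (hB : B.carrier.Finite) :
    ∃ M : FinQuot S Θ, M.recognised yn = B.carrier := by
  have : Finite B.alg := hB.to_subtype
  obtain ⟨A, ⟨θ⟩⟩ := exists_dual_equiv B.alg
  have hθ₁ : ∀ L, θ.hom (θ.inv L) = L := fun L =>
    congrArg (fun k : B.alg ⟶ B.alg => k L) θ.inv_hom_id
  have hθ₂ : ∀ p, θ.inv (θ.hom p) = p := fun p =>
    congrArg (fun k : (dualObj A).obj ⟶ (dualObj A).obj => k p) θ.hom_inv_id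
  let memHom (w : List Θ) : B.alg ⟶ S.OC := ⟨fun L => yn.symm (w ∈ RegLang.lang L.1),
    isHom_of_unordered fun _ _ => yn.symm_apply_apply _⟩
  -- Membership of `w` is a homomorphism to `O_𝒞`, so by fullness of the duality it is evaluation at
  -- a point of `A`.
  choose pt hpt using fun w => exists_ev_eq (θ.hom ≫ memHom w)
  have hpt' : ∀ w p, ev (pt w) p = yn.symm (w ∈ RegLang.lang (θ.hom p).1) := fun w p => by
    rw [hpt]; rfl
  have hext : ∀ p q : (dualObj A).obj, (∀ w, ev (pt w) p = ev (pt w) q) → p = q := by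
    intro p q h
    have : θ.hom p = θ.hom q := Subtype.ext (RegLang.ext (Set.ext fun w => iff_of_eq
      (yn.symm.injective (by
        have := h w
        rwa [hpt', hpt'] at this))))
    rw [← hθ₂ p, this, hθ₂]
  let e : Free S.D (List Θ) ⟶ A.obj := Free.lift pt
  have hept : ∀ w, e (Free.of w) = pt w := fun w => Free.lift_of _ _
  have he : Function.Surjective e := by
    have hA := A.2
    let I : FinAlg S.D := ⟨Alg.Hom.range e, (Set.toFinite (Set.range e)).to_subtype⟩
    -- All the points `pt w` lie in the range of `e`, so elements of the dual of `A` that agree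
    -- after restriction to the range agree on all words.
    let i : I.obj ⟶ A.obj := Alg.Hom.rangeIncl e
    have hi : Function.Surjective i := surjective_of_dual_injective i fun p q h =>
      hext p q fun w => by
        have hw : pt w = i ⟨e (Free.of w), _, rfl⟩ := (hept w).symm
        rw [hw]
        exact (ev_map i _ p).trans ((congrArg _ h).trans (ev_map i _ q).symm)
    intro a
    obtain ⟨x, rfl⟩ := hi a
    exact x.2
  -- An endomorphism of `B` that acts on membership through a map `k` of words dualises to an
  -- endomorphism of `A` sending `pt w` to `pt (k w)`. The left and right derivatives are the
  -- instances used below.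
  have htrans : ∀ (d : B.alg ⟶ B.alg) (k : List Θ → List Θ),
      (∀ L w, (w ∈ RegLang.lang (d L).1) = (k w ∈ RegLang.lang L.1)) →
      ∃ l : A.obj → A.obj, IsHom l ∧ ∀ w, l (pt w) = pt (k w) := by
    intro d k hd
    obtain ⟨l, hl⟩ := dualMap_surjective (θ.hom ≫ d ≫ θ.inv)
    refine ⟨l, l.isHom, fun w => eq_of_ev_eq fun p => ?_⟩
    rw [ev_map, hl, hpt', hpt', comp_apply, comp_apply, hθ₁, hd]
  have hleft : ∀ u, ∃ l : A.obj → A.obj, IsHom l ∧ ∀ w, l (pt w) = pt (u ++ w) := by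
    intro u
    induction u with
    | nil => exact ⟨_, isHom_id _, fun _ => rfl⟩
    | cons a u ih =>
      obtain ⟨l, hl, hlp⟩ := ih
      obtain ⟨l', hl', hlp'⟩ := htrans (B.toAutomaton.next a) (fun w => a :: w) fun _ _ => rfl
      exact ⟨_, hl'.comp hl, fun w => by rw [hlp, hlp']; rfl⟩
  have hright : ∀ v, ∃ r : A.obj → A.obj, IsHom r ∧ ∀ w, r (pt w) = pt (w ++ v) := by
    intro v
    induction v with
    | nil => exact ⟨_, isHom_id _, fun _ => by simp⟩
    | cons a v ih =>
      obtain ⟨r, hr, hrp⟩ := ih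
      obtain ⟨r', hr', hrp'⟩ := htrans
        ⟨fun L => ⟨RegLang.rightDeriv a L.1, B.rightDeriv_mem a _ L.2⟩,
          isHom_of_unordered fun _ _ => rfl⟩ (fun w => w ++ [a]) fun _ _ => rfl
      -- The order of composition is opposite to that on the left: `a` is appended before `v`.
      exact ⟨_, hr.comp hr', fun w => by rw [hrp', hrp]; simp⟩
  let M : FinQuot S Θ := ⟨_, A.2, (S.freeMon Θ).toQuotient e he
    (exists_translation_left S.D_entropic pt hleft)
    (exists_translation_right S.D_entropic pt hright), he⟩
  have hM : ∀ p : (dualObj A).obj, M.recLang yn p = (θ.hom p).1 := fun p =>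
    RegLang.ext (Set.ext fun w => iff_of_eq (yn.symm.injective (by
      refine Eq.trans (yn.symm_apply_apply (ev (e (Free.of w)) p)) ?_
      rw [hept, hpt']; rfl)))
  refine ⟨M, Set.ext fun L => ⟨?_, fun hL => ⟨θ.inv ⟨L, hL⟩, ?_⟩⟩⟩
  · rintro ⟨p, rfl⟩
    exact (hM p).symm ▸ (θ.hom p).2
  · exact (hM _).trans (congrArg Subtype.val (hθ₁ ⟨L, hL⟩))

end

/-! ### The correspondence between local varieties and local pseudovarieties -/

section Correspondence

variable {S : PredualPair.{u}} {yn : S.OC ≃ Prop} {Θ Δ E : Type u}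

theorem FinQuot.exists_cls_eq (c : Quo S Θ) : ∃ M : FinQuot S Θ, M.cls = c :=
  ⟨ofAntisymmetrization (· ≤ ·) c, toAntisymmetrization_ofAntisymmetrization _ c⟩

theorem FinQuot.cls_le_cls {M N : FinQuot S Θ} : M.cls ≤ N.cls ↔ M ≤ N := Iff.rfl

theorem FinQuot.cls_eq_cls {M N : FinQuot S Θ} : M.cls = N.cls ↔ M ≤ N ∧ N ≤ M := by
  rw [le_antisymm_iff, cls_le_cls, cls_le_cls]

/-- The local pseudovariety of the finite quotients that recognise only languages in a local
variety. -/
def LocalVariety.toPseudovariety (V : LocalVariety yn Θ) : LocalPseudovariety S Θ where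
  carrier := {c | ∃ M : FinQuot S Θ, M.cls = c ∧ M.recognised yn ⊆ V.carrier}
  lower' := by
    rintro _ c h ⟨M, rfl, hM⟩
    obtain ⟨N, rfl⟩ := FinQuot.exists_cls_eq c
    exact ⟨N, rfl, (FinQuot.recognised_mono yn (FinQuot.cls_le_cls.1 h)).trans hM⟩
  nonempty' := by
    obtain ⟨B, -, hB, hf⟩ := V.exists_finite ∅ Set.finite_empty (Set.empty_subset _)
    obtain ⟨M, hM⟩ := B.exists_recognised_eq hf
    exact ⟨M.cls, M, rfl, hM.subset.trans hB⟩
  directed' := by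
    rintro _ ⟨M, rfl, hM⟩ _ ⟨N, rfl, hN⟩
    obtain ⟨B, h, hB, hf⟩ := V.exists_finite _ ((M.finite_recognised yn).union
      (N.finite_recognised yn)) (Set.union_subset hM hN)
    obtain ⟨K, hK⟩ := B.exists_recognised_eq hf
    rw [← hK] at h hB
    exact ⟨K.cls, ⟨K, rfl, hB⟩,
      FinQuot.cls_le_cls.2 ((FinQuot.recognised_subset_iff yn).1 (Set.union_subset_iff.1 h).1),
      FinQuot.cls_le_cls.2 ((FinQuot.recognised_subset_iff yn).1 (Set.union_subset_iff.1 h).2)⟩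

/-- Isomorphic quotients recognise the same languages, so the choice of representative is
immaterial. -/
theorem LocalVariety.cls_mem_toPseudovariety {V : LocalVariety yn Θ} {M : FinQuot S Θ} :
    M.cls ∈ V.toPseudovariety ↔ M.recognised yn ⊆ V.carrier := by
  refine ⟨?_, fun h => ⟨M, rfl, h⟩⟩
  rintro ⟨N, h, hN⟩
  exact (FinQuot.recognised_mono yn (FinQuot.cls_eq_cls.1 h).2).trans hN

/-- Finitely many languages recognised by members of a local pseudovariety are recognised by a
single member. -/
theorem exists_recognised_superset (P : LocalPseudovariety S Θ) {s : Set (RegLang Θ)}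
    (hs : s.Finite) (h : ∀ L ∈ s, ∃ M : FinQuot S Θ, M.cls ∈ P ∧ L ∈ M.recognised yn) :
    ∃ M : FinQuot S Θ, M.cls ∈ P ∧ s ⊆ M.recognised yn := by
  induction s, hs using Set.Finite.induction_on with
  | empty =>
    obtain ⟨c, hc⟩ := P.nonempty
    obtain ⟨M, rfl⟩ := FinQuot.exists_cls_eq c
    exact ⟨M, hc, Set.empty_subset _⟩
  | insert _ _ ih =>
    obtain ⟨M, hM, hsM⟩ := ih fun L hL => h L (Set.mem_insert_of_mem _ hL)
    obtain ⟨N, hN, hLN⟩ := h _ (Set.mem_insert _ _)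
    obtain ⟨c, hc, hMc, hNc⟩ := P.directed _ hM _ hN
    obtain ⟨K, rfl⟩ := FinQuot.exists_cls_eq c
    exact ⟨K, hc, Set.insert_subset
      (FinQuot.recognised_mono yn (FinQuot.cls_le_cls.1 hNc) hLN)
      (hsM.trans (FinQuot.recognised_mono yn (FinQuot.cls_le_cls.1 hMc)))⟩

/-- The local variety of the languages recognised by the members of a local pseudovariety. -/
def toLocalVariety (yn : S.OC ≃ Prop) (P : LocalPseudovariety S Θ) : LocalVariety yn Θ where
  carrier := {L | ∃ M : FinQuot S Θ, M.cls ∈ P ∧ L ∈ M.recognised yn}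
  op_mem σ x hx := by
    obtain ⟨M, hM, h⟩ := exists_recognised_superset (yn := yn) P (Set.finite_range x) (by
      rintro _ ⟨i, rfl⟩
      exact hx i)
    exact ⟨M, hM, (M.recVariety yn).op_mem σ x fun i => h ⟨i, rfl⟩⟩
  next_mem := fun a L ⟨M, hM, hL⟩ => ⟨M, hM, (M.recVariety yn).next_mem a L hL⟩
  rightDeriv_mem := fun a L ⟨M, hM, hL⟩ => ⟨M, hM, (M.recVariety yn).rightDeriv_mem a L hL⟩

theorem toLocalVariety_toPseudovariety (V : LocalVariety yn Θ) :
    toLocalVariety yn V.toPseudovariety = V := by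
  refine LocalVariety.ext (Set.ext fun L => ⟨?_, fun hL => ?_⟩)
  · rintro ⟨M, hM, hL⟩
    exact LocalVariety.cls_mem_toPseudovariety.1 hM hL
  · obtain ⟨B, h, hB, hf⟩ := V.exists_finite {L} (Set.finite_singleton L)
      (Set.singleton_subset_iff.2 hL)
    obtain ⟨M, hM⟩ := B.exists_recognised_eq hf
    rw [← hM] at h hB
    exact ⟨M, LocalVariety.cls_mem_toPseudovariety.2 hB, h rfl⟩

/-- A finite quotient recognises only finitely many languages. Directedness gives one member of `P`
recognising them all, which therefore lies above the quotient. -/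
theorem toPseudovariety_toLocalVariety (P : LocalPseudovariety S Θ) :
    (toLocalVariety yn P).toPseudovariety = P := by
  refine SetLike.ext fun c => ?_
  obtain ⟨M, rfl⟩ := FinQuot.exists_cls_eq c
  rw [LocalVariety.cls_mem_toPseudovariety]
  refine ⟨fun h => ?_, fun h L hL => ⟨M, h, hL⟩⟩
  obtain ⟨N, hN, hMN⟩ := exists_recognised_superset P (M.finite_recognised yn) h
  exact P.lower (FinQuot.cls_le_cls.2 ((FinQuot.recognised_subset_iff yn).1 hMN)) hN

/-- The condition on morphisms between local pseudovarieties. -/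
def Lifts (f : S.freeMon Θ ⟶ S.freeMon Δ) (P : LocalPseudovariety S Θ)
    (Q : LocalPseudovariety S Δ) : Prop :=
  ∀ N : FinQuot S Δ, N.cls ∈ Q → ∃ M : FinQuot S Θ, M.cls ∈ P ∧ ∃ g : M.M ⟶ N.M,
    CommSq (C := VMon S.D) f M.e N.e g

/-- Since `f` may send a word to an element that is not a word, it is not evident that preimages
respect the wordwise operations. But finitely many languages of `W` are recognised by a single `N`,
and on those, membership of `w` in the preimage is evaluation at `e_N (f w)`, a `𝒞`-homomorphism. -/
theorem Lifts.closedUnderPreimages {f : S.freeMon Θ ⟶ S.freeMon Δ} {V : LocalVariety yn Θ}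
    {W : LocalVariety yn Δ} (h : Lifts f V.toPseudovariety W.toPseudovariety) :
    ClosedUnderPreimages yn f V W := by
  have hfin : ∀ s : Set (RegLang Δ), s.Finite → s ⊆ W.carrier →
      ∃ N : FinQuot S Δ, N.recognised yn ⊆ W.carrier ∧ s ⊆ N.recognised yn := by
    intro s hs hW
    obtain ⟨B, hsB, hB, hf⟩ := W.exists_finite s hs hW
    obtain ⟨N, hN⟩ := B.exists_recognised_eq hf
    exact ⟨N, hN.subset.trans hB, hsB.trans hN.superset⟩
  have hpre : ∀ L : W.carrier, ∃ K : V.carrier, K.1.lang = preimage yn f L.1.lang := by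
    rintro ⟨L, hL⟩
    obtain ⟨N, hN, hLN⟩ := hfin {L} (Set.finite_singleton L) (Set.singleton_subset_iff.2 hL)
    obtain ⟨p, rfl⟩ := hLN rfl
    obtain ⟨M, hM, g, hg⟩ := h N (LocalVariety.cls_mem_toPseudovariety.2 hN)
    exact ⟨⟨_, LocalVariety.cls_mem_toPseudovariety.1 hM ⟨_, rfl⟩⟩,
      (FinQuot.preimage_recLang yn hg.w p).symm⟩
  choose k hk using hpre
  refine ⟨⟨k, isHom_of_unordered fun σ x => Subtype.ext (RegLang.ext ?_)⟩, hk⟩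
  obtain ⟨N, hN, hx⟩ := hfin _ (Set.finite_range fun i => (x i).1) (by
    rintro _ ⟨i, rfl⟩
    exact (x i).2)
  choose p hp using fun i => hx ⟨i, rfl⟩
  refine (hk _).trans ?_
  have hσ : (W.alg.op σ x).1 = N.recLang yn ((dualObj N.finAlg).obj.op σ p) :=
    Eq.trans (congrArg ((regAlg yn Δ).op σ) (funext hp).symm)
      ((N.recHom yn).isHom.map_op σ p).symm
  refine Set.ext fun w => iff_of_eq ?_
  change (w ∈ preimage yn f (W.alg.op σ x).1.lang) =
    yn (S.OC.op σ fun i => yn.symm (w ∈ (k (x i)).1.lang))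
  rw [hσ, N.mem_preimage_recLang, (ev _).isHom.map_op]
  refine congrArg (fun z => yn (S.OC.op σ z)) (funext fun i => yn.injective ?_)
  have hki : (k (x i)).1.lang = preimage yn f (N.recLang yn (p i)).lang :=
    (hk (x i)).trans (congrArg (fun L : RegLang Δ => preimage yn f L.lang) (hp i).symm)
  rw [Equiv.apply_symm_apply, ← N.mem_preimage_recLang]
  exact congrArg (fun L : Language Θ => w ∈ L) hki.symm

/-- The preimages of the finitely many languages recognised by `N` lie in a finite local variety
inside `V`, and the quotient recognising the latter is the required source. -/
theorem ClosedUnderPreimages.lifts {f : S.freeMon Θ ⟶ S.freeMon Δ}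
    {V : LocalVariety yn Θ} {W : LocalVariety yn Δ} (h : ClosedUnderPreimages yn f V W) :
    Lifts f V.toPseudovariety W.toPseudovariety := by
  intro N hN
  rw [LocalVariety.cls_mem_toPseudovariety] at hN
  obtain ⟨k, hk⟩ := h
  have := (N.finite_recognised yn).to_subtype
  let s : Set (RegLang Θ) := Set.range fun L : N.recognised yn => (k ⟨L.1, hN L.2⟩).1
  obtain ⟨B, hs, hB, hf⟩ := V.exists_finite s (Set.finite_range _) (by
    rintro _ ⟨L, rfl⟩
    exact (k _).2)
  obtain ⟨M, hM⟩ := B.exists_recognised_eq hf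
  rw [← hM] at hs hB
  obtain ⟨g, hg⟩ := FinQuot.exists_hom_of_preimage_mem yn f M N fun L hL =>
    ⟨_, hs ⟨⟨L, hL⟩, rfl⟩, hk _⟩
  exact ⟨M, LocalVariety.cls_mem_toPseudovariety.2 hB, g, ⟨hg⟩⟩

theorem closedUnderPreimages_iff {f : S.freeMon Θ ⟶ S.freeMon Δ} {V : LocalVariety yn Θ}
    {W : LocalVariety yn Δ} : ClosedUnderPreimages yn f V W ↔
      Lifts f V.toPseudovariety W.toPseudovariety :=
  ⟨fun h => h.lifts, fun h => h.closedUnderPreimages⟩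

end Correspondence

/-! ### Images and products of monoids -/

section Constructions

variable {𝒱 : Variety.{u}}

/-- The range of a morphism of monoids. -/
def VMon.Hom.range {M N : VMon 𝒱} (f : M ⟶ N) : VMon 𝒱 where
  alg := Alg.Hom.range f.hom
  mon :=
    { mul := fun a b => ⟨a.1 * b.1, by
        obtain ⟨_, x, rfl⟩ := a
        obtain ⟨_, y, rfl⟩ := b
        exact ⟨x * y, f.map_mul x y⟩⟩
      one := ⟨1, 1, f.map_one⟩
      mul_assoc := fun _ _ _ => Subtype.ext (mul_assoc _ _ _)
      one_mul := fun _ => Subtype.ext (one_mul _)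
      mul_one := fun _ => Subtype.ext (mul_one _) }
  isHom_mul_left a := ⟨fun _ _ h => (N.isHom_mul_left a.1).mono h,
    fun σ _ => Subtype.ext ((N.isHom_mul_left a.1).map_op σ _)⟩
  isHom_mul_right b := ⟨fun _ _ h => (N.isHom_mul_right b.1).mono h,
    fun σ _ => Subtype.ext ((N.isHom_mul_right b.1).map_op σ _)⟩

/-- The inclusion of the range. -/
def VMon.Hom.rangeIncl {M N : VMon 𝒱} (f : M ⟶ N) : VMon.Hom.range f ⟶ N :=
  ⟨Alg.Hom.rangeIncl f.hom, rfl, fun _ _ => rfl⟩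

/-- The corestriction of a morphism to the range of another one. -/
def VMon.Hom.rangeLift {M N K : VMon 𝒱} (f : M ⟶ N) (g : K ⟶ N)
    (h : ∀ x, g.hom x ∈ Set.range f.hom) : K ⟶ VMon.Hom.range f :=
  ⟨Alg.Hom.rangeLift f.hom g.hom h, Subtype.ext (g.map_one :), fun a b => Subtype.ext (g.map_mul a b :)⟩

/-- The product of two algebras. -/
def Alg.prod (A B : Alg 𝒱) : Alg 𝒱 where
  carrier := A × B
  po := inferInstance
  op σ x := (A.op σ fun i => (x i).1, B.op σ fun i => (x i).2)
  op_mono σ _ _ h := ⟨A.op_mono σ fun i => (h i).1, B.op_mono σ fun i => (h i).2⟩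
  discrete hd _ _ h := Prod.ext (A.discrete hd _ _ h.1) (B.discrete hd _ _ h.2)
  sat p hp ρ := by
    have key : ∀ t : Term 𝒱.sig ℕ, t.eval (A := A × B)
        (fun σ x => (A.op σ fun i => (x i).1, B.op σ fun i => (x i).2)) ρ =
          (t.eval A.op fun n => (ρ n).1, t.eval B.op fun n => (ρ n).2) := by
      intro t
      induction t with
      | var n => rfl
      | app σ t ih => simp only [Term.eval, ih]
    rw [key, key]
    exact ⟨A.sat p hp _, B.sat p hp _⟩

/-- The product of two monoids. -/
def VMon.prod (M N : VMon 𝒱) : VMon 𝒱 where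
  alg := M.alg.prod N.alg
  mon := inferInstanceAs (Monoid (M.alg × N.alg))
  isHom_mul_left a :=
    ⟨fun _ _ h => ⟨(M.isHom_mul_left a.1).mono h.1, (N.isHom_mul_left a.2).mono h.2⟩,
      fun σ _ => Prod.ext ((M.isHom_mul_left a.1).map_op σ _) ((N.isHom_mul_left a.2).map_op σ _)⟩
  isHom_mul_right b :=
    ⟨fun _ _ h => ⟨(M.isHom_mul_right b.1).mono h.1, (N.isHom_mul_right b.2).mono h.2⟩,
      fun σ _ => Prod.ext ((M.isHom_mul_right b.1).map_op σ _)
        ((N.isHom_mul_right b.2).map_op σ _)⟩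

/-- The first projection. -/
def VMon.fst (M N : VMon 𝒱) : M.prod N ⟶ M :=
  ⟨⟨Prod.fst, fun _ _ h => h.1, fun _ _ => rfl⟩, rfl, fun _ _ => rfl⟩

/-- The second projection. -/
def VMon.snd (M N : VMon 𝒱) : M.prod N ⟶ N :=
  ⟨⟨Prod.snd, fun _ _ h => h.2, fun _ _ => rfl⟩, rfl, fun _ _ => rfl⟩

/-- The pairing of two morphisms. -/
def VMon.pair {K M N : VMon 𝒱} (f : K ⟶ M) (g : K ⟶ N) : K ⟶ M.prod N :=
  ⟨⟨fun x => (f.hom x, g.hom x), fun _ _ h => ⟨f.hom.isHom.mono h, g.hom.isHom.mono h⟩,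
    fun σ x => Prod.ext (f.hom.isHom.map_op σ x) (g.hom.isHom.map_op σ x)⟩,
    Prod.ext f.map_one g.map_one, fun a b => Prod.ext (f.map_mul a b) (g.map_mul a b)⟩

/-- The one-element monoid. -/
def VMon.trivial (𝒱 : Variety.{u}) : VMon 𝒱 where
  alg :=
    { carrier := PUnit
      po := inferInstance
      op := fun _ _ => ⟨⟩
      op_mono := fun _ _ _ _ => le_rfl
      discrete := fun _ _ _ _ => rfl
      sat := fun _ _ _ => le_rfl }
  mon := inferInstanceAs (Monoid PUnit.{u + 1})
  isHom_mul_left _ := ⟨fun _ _ _ => le_rfl, fun _ _ => rfl⟩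
  isHom_mul_right _ := ⟨fun _ _ _ => le_rfl, fun _ _ => rfl⟩

/-- The unique morphism to the one-element monoid. -/
def VMon.toTrivial (M : VMon 𝒱) : M ⟶ VMon.trivial 𝒱 :=
  ⟨⟨fun _ => ⟨⟩, fun _ _ _ => le_rfl, fun _ _ => rfl⟩, rfl, fun _ _ => rfl⟩

end Constructions

/-! ### The opfibrations -/

section Pushforward

variable {S : PredualPair.{u}} {Θ Δ E : Type u}

/-- The finite quotient obtained by factorising a morphism to a finite monoid. -/
def FinQuot.image {K : VMon S.D} [Finite K.alg] (f : S.freeMon Δ ⟶ K) : FinQuot S Δ where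
  M := VMon.Hom.range f
  finite := (Set.toFinite (Set.range f.hom)).to_subtype
  e := VMon.Hom.rangeLift f f fun x => ⟨x, rfl⟩
  surjective := fun ⟨_, x, hx⟩ => ⟨x, Subtype.ext hx⟩

/-- A finite quotient is compatible with the image of a morphism as soon as it is compatible with
the morphism. -/
theorem FinQuot.exists_commSq_image {w : S.freeMon Θ ⟶ S.freeMon Δ} {M : FinQuot S Θ}
    {K : VMon S.D} [Finite K.alg] {f : S.freeMon Δ ⟶ K} {g : M.M ⟶ K}
    (h : w ≫ f = M.e ≫ g) :
    ∃ g' : M.M ⟶ (FinQuot.image f).M, CommSq (C := VMon S.D) w M.e (FinQuot.image f).e g' := by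
  have hx : ∀ x, f.hom (w.hom x) = g.hom (M.e.hom x) := fun x =>
    congrArg (fun k : S.freeMon Θ ⟶ K => k.hom x) h
  refine ⟨VMon.Hom.rangeLift f g fun y => ?_,
    ⟨VMon.Hom.ext (EilenbergFib.hom_ext fun x => Subtype.ext (hx x))⟩⟩
  obtain ⟨x, rfl⟩ := M.surjective y
  exact ⟨w.hom x, hx x⟩

/-- The pushforward of a local pseudovariety along a morphism of free monoids. -/
def pushforward (w : S.freeMon Θ ⟶ S.freeMon Δ) (P : LocalPseudovariety S Θ) :
    LocalPseudovariety S Δ where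
  carrier := {c | ∃ N : FinQuot S Δ, N.cls = c ∧ ∃ M : FinQuot S Θ, M.cls ∈ P ∧
    ∃ g : M.M ⟶ N.M, CommSq (C := VMon S.D) w M.e N.e g}
  lower' := by
    rintro _ c h ⟨N, rfl, M, hM, g, hg⟩
    obtain ⟨K, rfl⟩ := FinQuot.exists_cls_eq c
    obtain ⟨k, hk⟩ := FinQuot.cls_le_cls.1 h
    exact ⟨K, rfl, M, hM, g ≫ k, ⟨by rw [hk, ← Category.assoc, hg.w, Category.assoc]⟩⟩
  nonempty' := by
    obtain ⟨c, hc⟩ := P.nonempty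
    obtain ⟨M, rfl⟩ := FinQuot.exists_cls_eq c
    exact ⟨_, ⟨VMon.trivial S.D, inferInstanceAs (Finite PUnit), VMon.toTrivial _,
      fun _ => ⟨1, rfl⟩⟩, rfl, M, hc, VMon.toTrivial _, ⟨rfl⟩⟩
  directed' := by
    rintro _ ⟨N₁, rfl, M₁, hM₁, g₁, hg₁⟩ _ ⟨N₂, rfl, M₂, hM₂, g₂, hg₂⟩
    obtain ⟨c, hc, h₁, h₂⟩ := P.directed _ hM₁ _ hM₂
    obtain ⟨M, rfl⟩ := FinQuot.exists_cls_eq c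
    obtain ⟨k₁, hk₁⟩ := FinQuot.cls_le_cls.1 h₁
    obtain ⟨k₂, hk₂⟩ := FinQuot.cls_le_cls.1 h₂
    have := N₁.finite
    have := N₂.finite
    have : Finite (N₁.M.prod N₂.M).alg := inferInstanceAs (Finite (N₁.M.alg × N₂.M.alg))
    -- The upper bound is the image of `ΨΔ*` in the product, the join of the two quotients.
    let f := VMon.pair N₁.e N₂.e
    have hf : w ≫ f = M.e ≫ VMon.pair (k₁ ≫ g₁) (k₂ ≫ g₂) := by
      refine VMon.Hom.ext (EilenbergFib.hom_ext fun x => Prod.ext ?_ ?_)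
      · exact congrArg (fun k : S.freeMon Θ ⟶ N₁.M => k.hom x)
          (show w ≫ N₁.e = M.e ≫ k₁ ≫ g₁ by rw [hg₁.w, hk₁, Category.assoc])
      · exact congrArg (fun k : S.freeMon Θ ⟶ N₂.M => k.hom x)
          (show w ≫ N₂.e = M.e ≫ k₂ ≫ g₂ by rw [hg₂.w, hk₂, Category.assoc])
    exact ⟨_, ⟨FinQuot.image f, rfl, M, hc, FinQuot.exists_commSq_image hf⟩,
      FinQuot.cls_le_cls.2 ⟨VMon.Hom.rangeIncl f ≫ VMon.fst _ _, rfl⟩,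
      FinQuot.cls_le_cls.2 ⟨VMon.Hom.rangeIncl f ≫ VMon.snd _ _, rfl⟩⟩

theorem lifts_pushforward (w : S.freeMon Θ ⟶ S.freeMon Δ) (P : LocalPseudovariety S Θ) :
    Lifts w P (pushforward w P) := by
  rintro N ⟨K, hK, M, hM, g, hg⟩
  obtain ⟨k, hk⟩ := (FinQuot.cls_eq_cls.1 hK).2
  exact ⟨M, hM, g ≫ k, ⟨by rw [hk, ← Category.assoc, hg.w, Category.assoc]⟩⟩

/-- The lift of `K` is the inclusion of the image of `g ≫ K.e`. This image belongs to the
pushforward because the factorisation of `w ≫ g ≫ K.e` through `M` corestricts to it. -/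
theorem Lifts.of_comp {w : S.freeMon Θ ⟶ S.freeMon Δ} {g : S.freeMon Δ ⟶ S.freeMon E}
    {P : LocalPseudovariety S Θ} {R : LocalPseudovariety S E} (h : Lifts (w ≫ g) P R) :
    Lifts g (pushforward w P) R := by
  intro K hK
  obtain ⟨M, hM, m, hm⟩ := h K hK
  have := K.finite
  exact ⟨FinQuot.image (g ≫ K.e), ⟨_, rfl, M, hM, FinQuot.exists_commSq_image
    ((Category.assoc _ _ _).symm.trans hm.w)⟩, VMon.Hom.rangeIncl _, ⟨rfl⟩⟩

end Pushforward

/-- For a faithful functor, the uniqueness part of the universal property of a strongly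
cocartesian morphism is automatic. -/
theorem isStronglyCocartesian_map {ℰ ℬ : Type*} [Category* ℰ] [Category* ℬ] (p : ℰ ⥤ ℬ)
    [p.Faithful] {X Y : ℰ} (φ : X ⟶ Y)
    (h : ∀ (Z : ℰ) (g : p.obj Y ⟶ p.obj Z) (ψ : X ⟶ Z), p.map ψ = p.map φ ≫ g →
      ∃ χ : Y ⟶ Z, p.map χ = g) : p.IsStronglyCocartesian (p.map φ) φ where
  universal_property' {Z} g ψ hψ := by
    have e : p.map φ ≫ g = p.map ψ := IsHomLift.eq_of_isHomLift p _ _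
    obtain ⟨χ, rfl⟩ := h Z g ψ e.symm
    refine ⟨χ, ⟨inferInstance, p.map_injective (by rw [p.map_comp, e])⟩, fun χ' hχ' => ?_⟩
    have := hχ'.1
    exact p.map_injective (IsHomLift.eq_of_isHomLift p _ _).symm

/-! ### Opcartesian lifts and the isomorphism over the base -/

section Main

variable {S : PredualPair.{u}} (yn : S.OC ≃ Prop)

instance : (FLang.p yn).Faithful := ⟨fun h => FLang.Hom.ext h⟩

instance : (FVar.q S).Faithful := ⟨fun h => FVar.Hom.ext h⟩

theorem isOpfibration_q (S : PredualPair.{u}) : IsOpfibration (FVar.q S) := by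
  intro X J w
  let Y : FVar S := ⟨J, pushforward w X.P⟩
  let f : X ⟶ Y := ⟨w, lifts_pushforward w X.P⟩
  exact ⟨Y, f, isStronglyCocartesian_map (FVar.q S) f fun Z g ψ h =>
    ⟨⟨g, Lifts.of_comp (h ▸ ψ.lifts)⟩, rfl⟩⟩

/-- The pushforward is transported along the bijection of the fibres; `closedUnderPreimages_iff`
carries its universal property over to languages. -/
theorem isOpfibration_p : IsOpfibration (FLang.p yn) := by
  intro X J w
  let Y : FLang yn := ⟨J, toLocalVariety yn (pushforward w X.V.toPseudovariety)⟩
  let f : X ⟶ Y := ⟨w, closedUnderPreimages_iff.2 (by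
    rw [toPseudovariety_toLocalVariety]
    exact lifts_pushforward w X.V.toPseudovariety)⟩
  refine ⟨Y, f, isStronglyCocartesian_map (FLang.p yn) f fun Z g ψ h =>
    ⟨⟨g, closedUnderPreimages_iff.2 ?_⟩, rfl⟩⟩
  rw [toPseudovariety_toLocalVariety]
  exact Lifts.of_comp (h ▸ ψ.closed.lifts)

/-- The functor from local varieties of languages to local pseudovarieties of monoids. -/
def FLang.toFVar : FLang yn ⥤ FVar S where
  obj X := ⟨X.base, X.V.toPseudovariety⟩
  map f := ⟨f.hom, f.closed.lifts⟩

/-- The functor from local pseudovarieties of monoids to local varieties of languages. -/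
def FVar.toFLang : FVar S ⥤ FLang yn where
  obj X := ⟨X.base, toLocalVariety yn X.P⟩
  map f := ⟨f.hom, closedUnderPreimages_iff.2 (by
    rw [toPseudovariety_toLocalVariety, toPseudovariety_toLocalVariety]
    exact f.lifts)⟩

/-- The composite functors fix objects only up to a propositional equality, so morphisms are
compared heterogeneously, through their base morphisms. -/
theorem FLang.Hom.heq {X X' Y Y' : FLang yn} (hX : X = X') (hY : Y = Y') {f : X ⟶ Y}
    {g : X' ⟶ Y'} (h : HEq f.hom g.hom) : HEq f g := by
  subst hX hY
  exact heq_of_eq (FLang.Hom.ext (eq_of_heq h))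

theorem FVar.Hom.heq {X X' Y Y' : FVar S} (hX : X = X') (hY : Y = Y') {f : X ⟶ Y}
    {g : X' ⟶ Y'} (h : HEq f.hom g.hom) : HEq f g := by
  subst hX hY
  exact heq_of_eq (FVar.Hom.ext (eq_of_heq h))

theorem toFVar_comp_toFLang : FLang.toFVar yn ⋙ FVar.toFLang yn = 𝟭 (FLang yn) := by
  have hobj : ∀ X, (FLang.toFVar yn ⋙ FVar.toFLang yn).obj X = X := fun X =>
    congrArg (FLang.mk X.base) (toLocalVariety_toPseudovariety X.V)
  exact Functor.hext hobj fun X Y _ => FLang.Hom.heq yn (hobj X) (hobj Y) HEq.rfl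

theorem toFLang_comp_toFVar : FVar.toFLang yn ⋙ FLang.toFVar yn = 𝟭 (FVar S) := by
  have hobj : ∀ X, (FVar.toFLang yn ⋙ FLang.toFVar yn).obj X = X := fun X =>
    congrArg (FVar.mk X.base) (toPseudovariety_toLocalVariety X.P)
  exact Functor.hext hobj fun X Y _ => FVar.Hom.heq (hobj X) (hobj Y) HEq.rfl

end Main

end EilenbergFib

end

/-- For predual varieties `𝒞` and `𝒟`, the projections `p : FLang ⥤ Free(Mon 𝒟)` and
`q : FVar ⥤ Free(Mon 𝒟)` are opfibrations, and they are isomorphic over the base. -/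
theorem mainTheorem2 (S : EilenbergFib.PredualPair.{u}) (yn : S.OC ≃ Prop) :
    EilenbergFib.IsOpfibration (EilenbergFib.FLang.p yn) ∧
      EilenbergFib.IsOpfibration (EilenbergFib.FVar.q S) ∧
      ∃ (I : EilenbergFib.FLang yn ⥤ EilenbergFib.FVar S)
        (J : EilenbergFib.FVar S ⥤ EilenbergFib.FLang yn),
        I ⋙ J = 𝟭 (EilenbergFib.FLang yn) ∧ J ⋙ I = 𝟭 (EilenbergFib.FVar S) ∧
          I ⋙ EilenbergFib.FVar.q S = EilenbergFib.FLang.p yn :=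
  ⟨EilenbergFib.isOpfibration_p yn, EilenbergFib.isOpfibration_q S,
    EilenbergFib.FLang.toFVar yn, EilenbergFib.FVar.toFLang yn,
    EilenbergFib.toFVar_comp_toFLang yn, EilenbergFib.toFLang_comp_toFVar yn, rfl⟩
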